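/- Let $K$ be an algebraically closed field of characteristic zero and let $n \ge 0$ be an integer. Let $\mathrm{Aut}(\mathbb A^n)$ be the group of polynomial automorphisms of $\mathbb A^n = K^n$, let $\mathrm{VF}(\mathbb A^n) = \mathrm{Der}_K(K[x_1,\dots,x_n])$ be the Lie algebra of polynomial vector fields with the commutator bracket, and for $\delta = \sum_i f_i\,\partial/\partial x_i$ put $\mathrm{Div}\,\delta = \sum_i \partial f_i/\partial x_i$. Let $$\mathrm{VF}^0(\mathbb A^n) = \{\delta \mid \mathrm{Div}\,\delta = 0\} \subseteq \mathrm{VF}^c(\mathbb A^n) = \{\delta \mid \mathrm{Div}\,\delta \in K\} \subseteq \mathrm{VF}(\mathbb A^n)$$ be the Lie subalgebras of vector fields of zero and of constant divergence. For $\varphi \in \mathrm{Aut}(\mathbb A^n)$ with comorphism $\varphi^* \colon f \mapsto f\circ\varphi$, set $\mathrm{Ad}(\varphi)\,\delta = (\varphi^*)^{-1}\circ\delta\circ\varphi^*$. Write $\mathrm{Aut}_{\mathrm{Lie}}(L)$ for the group of $K$-Lie algebra automorphisms of $L$. Then: 1. The map $\mathrm{Ad}\colon \mathrm{Aut}(\mathbb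 A^n) \to \mathrm{Aut}_{\mathrm{Lie}}(\mathrm{VF}(\mathbb A^n))$ is an isomorphism of groups. 2. Every Lie algebra automorphism of $\mathrm{VF}(\mathbb A^n)$ maps $\mathrm{VF}^c(\mathbb A^n)$ onto itself, and restriction is an isomorphism of groups $\mathrm{Aut}_{\mathrm{Lie}}(\mathrm{VF}(\mathbb A^n)) \to \mathrm{Aut}_{\mathrm{Lie}}(\mathrm{VF}^c(\mathbb A^n))$. 3. If $n \ne 1$, then every Lie algebra automorphism of $\mathrm{VF}^c(\mathbb A^n)$ maps $\mathrm{VF}^0(\mathbb A^n)$ onto itself, and restriction is an isomorphism of groups $\mathrm{Aut}_{\mathrm{Lie}}(\mathrm{VF}^c(\mathbb A^n)) \to \mathrm{Aut}_{\mathrm{Lie}}(\mathrm{VF}^0(\mathbb A^n))$. 4. Every Lie algebra automorphism of each of $\mathrm{VF}(\mathbb A^n)$, $\mathrm{VF}^c(\mathbb A^n)$ and $\mathrm{VF}^0(\mathbb A^n)$ is the restriction of $\mathrm{Ad}(\varphi)$ for some $\varphi \in \mathrm{Aut}(\mathbb A^n)$. -/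

import Mathlib

open MvPolynomial

noncomputable section

/-- The group of Lie algebra automorphisms of `L`; the product is composition. -/
instance instGroupLieAut (R L : Type*) [CommRing R] [LieRing L] [LieAlgebra R L] :
    Group (L ≃ₗ⁅R⁆ L) where
  mul f g := g.trans f
  one := 1
  inv f := f.symm
  mul_assoc _ _ _ := rfl
  one_mul _ := rfl
  mul_one _ := rfl
  inv_mul_cancel f := by
    apply DFunLike.ext
    intro x
    exact f.symm_apply_apply x

namespace AffineVF

section Auto

variable (K : Type*) [Field K] (n : ℕ)

/-- Polynomial maps from affine `n`-space `K ^ n` to itself. -/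
def IsPolyMap (f : (Fin n → K) → (Fin n → K)) : Prop :=
  ∃ F : Fin n → MvPolynomial (Fin n) K, ∀ a i, f a i = eval a (F i)

variable {K n} in
theorem IsPolyMap.comp {f g : (Fin n → K) → (Fin n → K)}
    (hf : IsPolyMap K n f) (hg : IsPolyMap K n g) : IsPolyMap K n (f ∘ g) := by
  obtain ⟨F, hF⟩ := hf
  obtain ⟨G, hG⟩ := hg
  refine ⟨fun i => aeval G (F i), fun a i => ?_⟩
  have h : g a = fun j => eval a (G j) := funext fun j => hG a j
  have h2 : ∀ p : MvPolynomial (Fin n) K,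
      eval a (aeval G p) = eval (fun j => eval a (G j)) p := fun p => by
    induction p using MvPolynomial.induction_on with
    | C c => simp
    | add p q hp hq => rw [map_add, map_add, map_add, hp, hq]
    | mul_X p j hp => rw [map_mul, map_mul, map_mul, hp, aeval_X, eval_X]
  rw [Function.comp_apply, hF, h, h2]

/-- The group of polynomial automorphisms of affine `n`-space `K ^ n`: the bijections `φ` of
`K ^ n` such that `φ` and its inverse are polynomial maps. -/
def Aut : Subgroup (Equiv.Perm (Fin n → K)) where
  carrier := {φ | IsPolyMap K n φ ∧ IsPolyMap K n φ.symm}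
  mul_mem' h₁ h₂ := ⟨h₁.1.comp h₂.1, h₂.2.comp h₁.2⟩
  one_mem' := ⟨⟨X, fun _ _ => by simp⟩, ⟨X, fun a i => by
    rw [eval_X]
    rfl⟩⟩
  inv_mem' h := ⟨h.2, h.1⟩

end Auto

section Comorphism

variable {K : Type*} [Field K] {n : ℕ}

/-- The coordinate polynomials of a polynomial automorphism. -/
def coords (φ : Aut K n) : Fin n → MvPolynomial (Fin n) K := φ.2.1.choose

theorem eval_coords (φ : Aut K n) (a : Fin n → K) (i : Fin n) :
    eval a (coords φ i) = φ.1 a i := (φ.2.1.choose_spec a i).symm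

theorem eval_aeval_coords (φ : Aut K n) (a : Fin n → K) (p : MvPolynomial (Fin n) K) :
    eval a (aeval (coords φ) p) = eval (φ.1 a) p := by
  induction p using MvPolynomial.induction_on with
  | C c => simp
  | add p q hp hq => rw [map_add, map_add, map_add, hp, hq]
  | mul_X p j hp => rw [map_mul, map_mul, map_mul, hp, aeval_X, eval_X, eval_coords]

variable [Infinite K]

/-- The comorphism `φ^* : f ↦ f ∘ φ` of a polynomial automorphism, as an automorphism of the
polynomial ring; see `eval_comorphism`. -/
def comorphism (φ : Aut K n) : MvPolynomial (Fin n) K ≃ₐ[K] MvPolynomial (Fin n) K :=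
  AlgEquiv.ofAlgHom (aeval (coords φ)) (aeval (coords φ⁻¹))
    (AlgHom.ext fun p => MvPolynomial.funext fun a => by
      rw [AlgHom.comp_apply, eval_aeval_coords, eval_aeval_coords]
      exact congrArg (fun b => eval b p) (φ.1.symm_apply_apply a))
    (AlgHom.ext fun p => MvPolynomial.funext fun a => by
      rw [AlgHom.comp_apply, eval_aeval_coords, eval_aeval_coords]
      exact congrArg (fun b => eval b p) (φ.1.apply_symm_apply a))

theorem eval_comorphism (φ : Aut K n) (a : Fin n → K) (f : MvPolynomial (Fin n) K) :
    eval a (comorphism φ f) = eval (φ.1 a) f := eval_aeval_coords φ a f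

theorem comorphism_mul (φ ψ : Aut K n) (f : MvPolynomial (Fin n) K) :
    comorphism (φ * ψ) f = comorphism ψ (comorphism φ f) :=
  MvPolynomial.funext fun a => by
    rw [eval_comorphism, eval_comorphism, eval_comorphism]
    rfl

theorem comorphism_one (f : MvPolynomial (Fin n) K) : comorphism (1 : Aut K n) f = f :=
  MvPolynomial.funext fun a => by
    rw [eval_comorphism]
    rfl

end Comorphism

section VectorFields

variable (K : Type*) [Field K] (n : ℕ)

/-- The Lie algebra of polynomial vector fields on affine `n`-space, i.e. of `K`-derivations of
`K[x_1, …, x_n]`, with the commutator bracket. -/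
abbrev VF : Type _ := Derivation K (MvPolynomial (Fin n) K) (MvPolynomial (Fin n) K)

variable {K n}

/-- The divergence `∑ ∂ f_i / ∂ x_i` of `δ = ∑ f_i ∂ / ∂ x_i`, where `f_i = δ x_i`. -/
def divergence (δ : VF K n) : MvPolynomial (Fin n) K := ∑ i, pderiv i (δ (X i))

theorem divergence_add (δ η : VF K n) :
    divergence (δ + η) = divergence δ + divergence η := by
  simp [divergence, Finset.sum_add_distrib]

theorem divergence_smul (c : K) (δ : VF K n) : divergence (c • δ) = c • divergence δ := by
  simp [divergence, Finset.smul_sum]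

theorem divergence_zero : divergence (0 : VF K n) = 0 := by
  simp [divergence]

theorem apply_eq_sum (δ : VF K n) (f : MvPolynomial (Fin n) K) :
    δ f = ∑ i, δ (X i) * pderiv i f := by
  have hs : ∀ (D : Fin n → VF K n) (g : MvPolynomial (Fin n) K), (∑ i, D i) g = ∑ i, D i g :=
    fun D g => by
      have := map_sum (Derivation.coeFnAddMonoidHom (R := K) (A := MvPolynomial (Fin n) K)
        (M := MvPolynomial (Fin n) K)) D Finset.univ
      have h2 := congrFun this g
      rw [Finset.sum_apply] at h2
      exact h2
  have h : δ = ∑ i, δ (X i) • pderiv (R := K) i := by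
    apply MvPolynomial.derivation_ext
    intro j
    rw [hs]
    simp [pderiv_X, Pi.single_apply]
  conv_lhs => rw [h]
  rw [hs]
  simp

theorem pderiv_comm' (i j : Fin n) (f : MvPolynomial (Fin n) K) :
    pderiv i (pderiv j f) = pderiv j (pderiv i f) := by
  have h : ⁅pderiv (R := K) i, pderiv j⁆ = (0 : VF K n) := by
    apply MvPolynomial.derivation_ext
    intro k
    rw [Derivation.commutator_apply]
    simp only [pderiv_X, Derivation.zero_apply, Pi.single_apply]
    split_ifs <;> simp
  have h2 := congrArg (fun D : VF K n => D f) h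
  simp only [Derivation.commutator_apply, Derivation.zero_apply] at h2
  exact sub_eq_zero.mp h2

theorem divergence_lie (δ η : VF K n) :
    divergence ⁅δ, η⁆ = δ (divergence η) - η (divergence δ) := by
  have key : ∀ α β : VF K n, ∑ i, pderiv i (α (β (X i))) =
      (∑ i, ∑ j, pderiv i (α (X j)) * pderiv j (β (X i))) + α (divergence β) := by
    intro α β
    rw [divergence, map_sum, ← Finset.sum_add_distrib]
    refine Finset.sum_congr rfl fun i _ => ?_
    rw [apply_eq_sum α (β (X i)), apply_eq_sum α (pderiv i (β (X i))), map_sum,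
      ← Finset.sum_add_distrib]
    refine Finset.sum_congr rfl fun j _ => ?_
    rw [Derivation.leibniz, smul_eq_mul, smul_eq_mul, pderiv_comm' i j]
    ring
  have hl : divergence ⁅δ, η⁆ =
      (∑ i, pderiv i (δ (η (X i)))) - ∑ i, pderiv i (η (δ (X i))) := by
    simp [divergence, Derivation.commutator_apply, Finset.sum_sub_distrib]
  rw [hl, key, key, Finset.sum_comm]
  simp_rw [mul_comm]
  ring

variable (K n)

/-- Vector fields of constant divergence. -/
def VFc : LieSubalgebra K (VF K n) where
  carrier := {δ | ∃ c : K, divergence δ = C c}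
  add_mem' := by
    rintro δ η ⟨c, hc⟩ ⟨d, hd⟩
    exact ⟨c + d, by rw [divergence_add, hc, hd, map_add]⟩
  zero_mem' := ⟨0, by rw [divergence_zero, map_zero]⟩
  smul_mem' := by
    rintro r δ ⟨c, hc⟩
    exact ⟨r * c, by rw [divergence_smul, hc, smul_eq_C_mul, map_mul]⟩
  lie_mem' := by
    rintro δ η ⟨c, hc⟩ ⟨d, hd⟩
    exact ⟨0, by rw [divergence_lie, hc, hd]; simp⟩

/-- Vector fields of divergence zero. -/
def VF0 : LieSubalgebra K (VF K n) where
  carrier := {δ | divergence δ = 0}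
  add_mem' := by
    intro δ η (hc : divergence δ = 0) (hd : divergence η = 0)
    change divergence (δ + η) = 0
    rw [divergence_add, hc, hd, add_zero]
  zero_mem' := divergence_zero
  smul_mem' := by
    intro r δ (hc : divergence δ = 0)
    change divergence (r • δ) = 0
    rw [divergence_smul, hc, smul_zero]
  lie_mem' := by
    intro δ η (hc : divergence δ = 0) (hd : divergence η = 0)
    change divergence ⁅δ, η⁆ = 0
    rw [divergence_lie, hc, hd, map_zero, map_zero, sub_zero]

theorem VF0_le_VFc : VF0 K n ≤ VFc K n :=
  fun _ hδ => ⟨0, Eq.trans hδ (map_zero C).symm⟩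

end VectorFields

section AdjointAction

variable {K : Type*} [Field K] {n : ℕ}

/-- For an algebra automorphism `s` and a derivation `δ` of the polynomial ring, the derivation
`s⁻¹ ∘ δ ∘ s`. -/
def conj (s : MvPolynomial (Fin n) K ≃ₐ[K] MvPolynomial (Fin n) K) (δ : VF K n) : VF K n where
  toFun f := s.symm (δ (s f))
  map_add' f g := by simp
  map_smul' c f := by simp
  map_one_eq_zero' := by simp
  leibniz' f g := by simp

theorem conj_apply (s : MvPolynomial (Fin n) K ≃ₐ[K] MvPolynomial (Fin n) K) (δ : VF K n)
    (f : MvPolynomial (Fin n) K) : conj s δ f = s.symm (δ (s f)) := rfl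

variable [Infinite K] (K n)

/-- The homomorphism `Ad` from the group of polynomial automorphisms of affine `n`-space to the
group of Lie algebra automorphisms of its vector fields: `Ad φ δ = (φ^*)⁻¹ ∘ δ ∘ φ^*`. -/
def Ad : Aut K n →* (VF K n ≃ₗ⁅K⁆ VF K n) where
  toFun φ :=
    { toFun := conj (comorphism φ)
      map_add' := fun δ η => by ext; simp [conj_apply]
      map_smul' := fun c δ => by ext; simp [conj_apply]
      map_lie' := fun {δ η} => by ext; simp [conj_apply, Derivation.commutator_apply]
      invFun := conj (comorphism φ).symm
      left_inv := fun δ => by ext; simp [conj_apply]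
      right_inv := fun δ => by ext; simp [conj_apply] }
  map_one' := by
    apply DFunLike.ext
    intro δ
    apply Derivation.ext
    intro f
    change (comorphism 1).symm (δ (comorphism 1 f)) = δ f
    rw [AlgEquiv.symm_apply_eq, comorphism_one, comorphism_one]
  map_mul' φ ψ := by
    apply DFunLike.ext
    intro δ
    apply Derivation.ext
    intro f
    change (comorphism (φ * ψ)).symm (δ (comorphism (φ * ψ) f)) =
      (comorphism φ).symm ((comorphism ψ).symm (δ (comorphism ψ (comorphism φ f))))
    rw [AlgEquiv.symm_apply_eq, comorphism_mul, comorphism_mul]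
    simp

variable {K n}

theorem Ad_apply (φ : Aut K n) (δ : VF K n) (f : MvPolynomial (Fin n) K) :
    Ad K n φ δ f = (comorphism φ).symm (δ (comorphism φ f)) := rfl

end AdjointAction

end AffineVF

end

/-! Let `θ` be an automorphism of one of the three algebras `L`, and let `D k` be the image of
`∂_k`. The fields `D k` commute, are linearly independent over `K`, span their own centraliser in
`L`, and are ad-nilpotent on `L` (`IsFrame`). The aim is to show that such a family is a coordinate
frame.

Local nilpotency. On all vector fields, `ad(D)^m (f D) = D^m(f) D`. On divergence-free or
constant-divergence fields, a divergence-free ad-nilpotent `D` is nilpotent on determinants of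
coefficients of fields in `L`, and every `x_i` is such a determinant.

Constants. If all `D k` kill `f`, then each `f D_k` lies in `L` and commutes with the frame. Hence
`f` preserves a finite-dimensional space, is integral over `K`, and is a scalar.

Coordinates. A locally nilpotent derivation with `D f = h f` has `h f = 0`. This makes the frame
independent over the polynomial ring, with scalar determinant, so it is a basis of all fields.
Expanding the image of a diagonal field in this basis yields functions `f_l` with `D_k f_l = δ_kl`;
they generate the polynomial ring freely (`IsFrame.exists_algEquiv`).

Rigidity. After a conjugation, `θ` fixes every `∂_k` and one diagonal field with nonzero weights. A
field whose brackets with all `∂_k` are fixed is moved only by a constant field, which weights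
exclude; generators then give all of `L`. Thus `θ` is an adjoint action. The same fixed fields show
that this action is faithful, except on `VF0` for `n = 1`, and the restriction isomorphisms follow.
-/

noncomputable section

namespace AffineVF

/-! ### Locally nilpotent derivations. -/

section Nilpotent

variable {K : Type*} [Field K] {n : ℕ}

/-- Some power of the derivation `D` kills `f`. -/
def IsNilAt (D : VF K n) (f : MvPolynomial (Fin n) K) : Prop := ∃ m : ℕ, D^[m] f = 0

/-- The derivation `D` is locally nilpotent. -/
def IsLocNil (D : VF K n) : Prop := ∀ f, IsNilAt D f

theorem iterate_eq_zero_of_le {D : VF K n} {f : MvPolynomial (Fin n) K} {m l : ℕ} (h : m ≤ l)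
    (hm : D^[m] f = 0) : D^[l] f = 0 := by
  obtain ⟨k, rfl⟩ := Nat.exists_eq_add_of_le' h
  rw [Function.iterate_add_apply, hm, iterate_map_zero]

theorem IsNilAt.of_apply {D : VF K n} {f : MvPolynomial (Fin n) K} (h : IsNilAt D (D f)) :
    IsNilAt D f := by
  obtain ⟨m, hm⟩ := h
  exact ⟨m + 1, hm⟩

theorem isNilAt_of_apply_eq_zero {D : VF K n} {f : MvPolynomial (Fin n) K} (h : D f = 0) :
    IsNilAt D f := ⟨1, h⟩

theorem isNilAt_zero (D : VF K n) : IsNilAt D 0 := ⟨0, rfl⟩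

theorem IsNilAt.add {D : VF K n} {f g : MvPolynomial (Fin n) K} (hf : IsNilAt D f)
    (hg : IsNilAt D g) : IsNilAt D (f + g) := by
  obtain ⟨a, ha⟩ := hf
  obtain ⟨b, hb⟩ := hg
  refine ⟨max a b, ?_⟩
  rw [iterate_map_add, iterate_eq_zero_of_le (le_max_left a b) ha,
    iterate_eq_zero_of_le (le_max_right a b) hb, add_zero]

theorem isNilAt_sum {ι : Type*} {D : VF K n} {f : ι → MvPolynomial (Fin n) K} {s : Finset ι}
    (h : ∀ i ∈ s, IsNilAt D (f i)) : IsNilAt D (∑ i ∈ s, f i) := by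
  classical
  induction s using Finset.induction_on with
  | empty => simpa using isNilAt_zero D
  | insert a s ha ih =>
    rw [Finset.sum_insert ha]
    exact (h a (Finset.mem_insert_self a s)).add
      (ih fun i hi => h i (Finset.mem_insert_of_mem hi))

theorem IsNilAt.mul {D : VF K n} {f g : MvPolynomial (Fin n) K} (hf : IsNilAt D f)
    (hg : IsNilAt D g) : IsNilAt D (f * g) := by
  obtain ⟨a, ha⟩ := hf
  obtain ⟨b, hb⟩ := hg
  induction hs : a + b generalizing a b f g with
  | zero =>
    obtain rfl : a = 0 := by omega
    have : f = 0 := ha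
    rw [this, zero_mul]
    exact isNilAt_zero D
  | succ s ih =>
    rcases a with _ | a
    · have : f = 0 := ha
      rw [this, zero_mul]
      exact isNilAt_zero D
    rcases b with _ | b
    · have : g = 0 := hb
      rw [this, mul_zero]
      exact isNilAt_zero D
    apply IsNilAt.of_apply
    rw [Derivation.leibniz, smul_eq_mul, smul_eq_mul]
    exact (ih (a + 1) ha b hb (by omega)).add (ih (b + 1) hb a ha (by omega))

theorem isLocNil_of_X {D : VF K n} (h : ∀ i, IsNilAt D (X i)) : IsLocNil D := by
  intro f
  induction f using MvPolynomial.induction_on with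
  | C c => exact isNilAt_of_apply_eq_zero (derivation_C D c)
  | add p q hp hq => exact hp.add hq
  | mul_X p j hp => exact hp.mul (h j)

/-- In the Leibniz expansion of `D^[m + l] (f * g)` only one term survives. The scalar is a binomial
coefficient, but only its nonvanishing matters. -/
theorem iterate_mul_top (D : VF K n) (s : ℕ) : ∀ (m l : ℕ) (f g : MvPolynomial (Fin n) K),
    m + l = s → D^[m + 1] f = 0 → D^[l + 1] g = 0 →
      ∃ c : ℕ, c ≠ 0 ∧ D^[s] (f * g) = c • (D^[m] f * D^[l] g) := by
  induction s with
  | zero =>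
    rintro m l f g hs hf hg
    obtain ⟨rfl, rfl⟩ : m = 0 ∧ l = 0 := by omega
    exact ⟨1, one_ne_zero, by simp⟩
  | succ s ih =>
    rintro m l f g hs hf hg
    rw [Function.iterate_succ_apply, Derivation.leibniz, smul_eq_mul, smul_eq_mul,
      iterate_map_add]
    rcases m with _ | m
    · have hf' : D f = 0 := hf
      rcases l with _ | l
      · omega
      obtain ⟨c, hc, h⟩ := ih 0 l f (D g) (by omega) hf hg
      exact ⟨c, hc, by rw [h, hf', mul_zero, iterate_map_zero, add_zero]; rfl⟩
    · obtain ⟨c, hc, h⟩ := ih l m g (D f) (by omega) hg hf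
      rcases l with _ | l
      · have hg' : D g = 0 := hg
        exact ⟨c, hc, by
          rw [h, hg', mul_zero, iterate_map_zero, zero_add, mul_comm]; rfl⟩
      · obtain ⟨d, hd, h'⟩ := ih (m + 1) l f (D g) (by omega) hf hg
        refine ⟨d + c, by omega, ?_⟩
        rw [h, h', add_smul, mul_comm (D^[l + 1] g)]
        rfl

theorem exists_last_iterate {D : VF K n} {f : MvPolynomial (Fin n) K} (h : IsNilAt D f)
    (hf : f ≠ 0) : ∃ m, D^[m + 1] f = 0 ∧ D^[m] f ≠ 0 := by
  classical
  have hpos : Nat.find h ≠ 0 := fun h0 => hf (by simpa [h0] using Nat.find_spec h)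
  obtain ⟨m, hm⟩ := Nat.exists_eq_succ_of_ne_zero hpos
  exact ⟨m, by simpa [hm] using Nat.find_spec h, Nat.find_min h (by omega)⟩

/-- A locally nilpotent derivation has no eigenvectors with nonzero eigenvalue, even with
polynomial eigenvalues. -/
theorem IsLocNil.eq_zero_of_apply_eq_mul [CharZero K] {D : VF K n} (hD : IsLocNil D)
    {f h : MvPolynomial (Fin n) K} (hf : D f = h * f) : h * f = 0 := by
  by_contra hne
  obtain ⟨hh, hf0⟩ := mul_ne_zero_iff.mp hne
  obtain ⟨m, hm, hm'⟩ := exists_last_iterate (hD h) hh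
  obtain ⟨l, hl, hl'⟩ := exists_last_iterate (hD f) hf0
  -- The nilpotency orders of `h` and `f` add up in `h * f`, yet `h * f = D f` has smaller order
  -- than `f`.
  obtain ⟨c, hc, h⟩ := iterate_mul_top D (m + l) m l h f rfl hm hl
  rw [← hf, ← Function.iterate_succ_apply, iterate_eq_zero_of_le (by omega) hl] at h
  exact smul_ne_zero hc (mul_ne_zero hm' hl') h.symm

theorem iterate_pow_mul (D : VF K n) {f : MvPolynomial (Fin n) K} (hf : D f = 1) (m : ℕ) :
    ∀ {c : MvPolynomial (Fin n) K}, D c = 0 → D^[m] (f ^ m * c) = (m.factorial : K) • c := by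
  induction m with
  | zero => intro c _; simp
  | succ m ih =>
    intro c hc
    have : D (f ^ (m + 1) * c) = ((m + 1 : ℕ) : K) • (f ^ m * c) := by
      rw [Derivation.leibniz, hc, Derivation.leibniz_pow, hf, smul_zero, zero_add,
        Nat.cast_smul_eq_nsmul, Nat.add_sub_cancel]
      simp only [smul_eq_mul, nsmul_eq_mul, mul_one]
      ring
    have hsmul : ∀ (a : K) (g : MvPolynomial (Fin n) K), D^[m] (a • g) = a • D^[m] g :=
      fun a g => (Function.Semiconj.iterate_right (f := fun g => a • g)
        (fun g => (D.map_smul a g).symm) m g).symm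
    rw [Function.iterate_succ_apply, this, hsmul, ih hc, smul_smul, Nat.factorial_succ]
    push_cast
    rfl

end Nilpotent

/-! ### Derivatives of coefficient determinants. -/

section Determinant

variable {K : Type*} [Field K] {n : ℕ}

theorem derivation_prod {ι : Type*} [DecidableEq ι] (D : VF K n) (s : Finset ι)
    (f : ι → MvPolynomial (Fin n) K) :
    D (∏ i ∈ s, f i) = ∑ i ∈ s, ∏ j ∈ s, Function.update f i (D (f i)) j := by
  induction s using Finset.induction_on with
  | empty => simp
  | insert a s ha ih =>
    rw [Finset.prod_insert ha, Derivation.leibniz, ih, Finset.sum_insert ha,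
      Finset.prod_insert ha, Function.update_self, add_comm, smul_eq_mul, smul_eq_mul,
      Finset.mul_sum, mul_comm]
    congr 1
    · congr 1
      exact Finset.prod_congr rfl fun j hj => by
        rw [Function.update_of_ne (ne_of_mem_of_not_mem hj ha)]
    · refine Finset.sum_congr rfl fun i hi => ?_
      rw [Finset.prod_insert ha, Function.update_of_ne (ne_of_mem_of_not_mem hi ha).symm]

theorem derivation_det (D : VF K n) (M : Matrix (Fin n) (Fin n) (MvPolynomial (Fin n) K)) :
    D M.det = ∑ i, (M.updateRow i fun j => D (M i j)).det := by
  have hz : ∀ (z : ℤˣ) (g : MvPolynomial (Fin n) K), D (z • g) = z • D g := fun z g => by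
    rw [Units.smul_def, Units.smul_def, map_zsmul]
  simp_rw [Matrix.det_apply]
  rw [map_sum, Finset.sum_comm]
  refine Finset.sum_congr rfl fun σ _ => ?_
  rw [hz, derivation_prod, ← Finset.smul_sum]
  congr 1
  -- The `k`-th factor is `M (σ k) k`, so differentiating it amounts to differentiating row `σ k`;
  -- the sum is reindexed by `σ`.
  refine Eq.trans ?_ (Equiv.sum_comp σ _)
  refine Finset.sum_congr rfl fun i _ => Finset.prod_congr rfl fun k _ => ?_
  rw [Matrix.updateRow_apply, Function.update_apply]
  by_cases h : k = i
  · rw [if_pos h, if_pos (congrArg σ h), h]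
  · rw [if_neg h, if_neg fun h' => h (σ.injective h')]

/-- The matrix of coefficients of vector fields. -/
def coeffMatrix (E : Fin n → VF K n) : Matrix (Fin n) (Fin n) (MvPolynomial (Fin n) K) :=
  Matrix.of fun i j => E i (X j)

/-- Cofactor expansion along row `i` makes each summand a diagonal entry of `M * J * adj M`; the
trace is cyclic. -/
theorem sum_det_updateRow_mul (M J : Matrix (Fin n) (Fin n) (MvPolynomial (Fin n) K)) :
    ∑ i, (M.updateRow i ((M * J) i)).det = J.trace * M.det := by
  have h : ∀ i, (M.updateRow i ((M * J) i)).det = (M * J * M.adjugate) i i := by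
    intro i
    rw [Matrix.mul_apply, Matrix.det_eq_sum_mul_adjugate_row _ i]
    refine Finset.sum_congr rfl fun j _ => ?_
    rw [Matrix.updateRow_self, Matrix.adjugate_apply, Matrix.adjugate_apply,
      Matrix.updateRow_idem]
  simp_rw [h]
  change (M * J * M.adjugate).trace = _
  rw [Matrix.mul_assoc, Matrix.trace_mul_comm, Matrix.mul_assoc, Matrix.adjugate_mul]
  simp [mul_comm]

/-- The Lie derivative of the standard volume form along `D` is `divergence D` times that form; this
is the Leibniz rule for the form evaluated on the fields `E i`. -/
theorem derivation_det_coeffMatrix (D : VF K n) (E : Fin n → VF K n) :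
    D (coeffMatrix E).det =
      (∑ i, (coeffMatrix (Function.update E i ⁅D, E i⁆)).det) +
        divergence D * (coeffMatrix E).det := by
  have htr : divergence D =
      (Matrix.of fun l j => pderiv l (D (X j)) :
        Matrix (Fin n) (Fin n) (MvPolynomial (Fin n) K)).trace := rfl
  rw [htr, ← sum_det_updateRow_mul, ← Finset.sum_add_distrib, derivation_det]
  refine Finset.sum_congr rfl fun i _ => ?_
  have h1 : coeffMatrix (Function.update E i ⁅D, E i⁆) =
      (coeffMatrix E).updateRow i fun j => ⁅D, E i⁆ (X j) := by
    ext a b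
    by_cases h : a = i
    · subst h; simp [coeffMatrix]
    · simp [coeffMatrix, h]
  rw [h1, ← Matrix.det_updateRow_add]
  congr 2
  funext j
  simp only [Pi.add_apply, Derivation.commutator_apply, coeffMatrix, Matrix.of_apply,
    Matrix.mul_apply]
  rw [apply_eq_sum (E i) (D (X j))]
  ring

end Determinant

/-! ### Coordinate, monomial and diagonal fields. -/

section Fields

variable {K : Type*} [Field K] {n : ℕ}

/-- The vector field `f ∂ / ∂ x_i`. -/
def monoField (f : MvPolynomial (Fin n) K) (i : Fin n) : VF K n := f • pderiv i

theorem monoField_apply (f g : MvPolynomial (Fin n) K) (i : Fin n) :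
    monoField f i g = f * pderiv i g := rfl

theorem monoField_apply_X (f : MvPolynomial (Fin n) K) (i j : Fin n) :
    monoField f i (X j) = if j = i then f else 0 := by
  rw [monoField_apply, pderiv_X, Pi.single_apply]
  split_ifs <;> simp

theorem monoField_one (i : Fin n) : monoField (1 : MvPolynomial (Fin n) K) i = pderiv i :=
  one_smul _ _

theorem monoField_zero (i : Fin n) : monoField (0 : MvPolynomial (Fin n) K) i = 0 :=
  zero_smul _ _

theorem monoField_add (f g : MvPolynomial (Fin n) K) (i : Fin n) :
    monoField (f + g) i = monoField f i + monoField g i := add_smul _ _ _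

theorem monoField_smul (c : K) (f : MvPolynomial (Fin n) K) (i : Fin n) :
    monoField (c • f) i = c • monoField f i := smul_assoc _ _ _

theorem lie_monoField (f g : MvPolynomial (Fin n) K) (i j : Fin n) :
    ⁅monoField f i, monoField g j⁆ =
      monoField (f * pderiv i g) j - monoField (g * pderiv j f) i := by
  apply Derivation.ext
  intro h
  rw [Derivation.commutator_apply, Derivation.sub_apply]
  simp only [monoField_apply, Derivation.leibniz, smul_eq_mul]
  rw [pderiv_comm' j i]
  ring

theorem lie_pderiv_monoField (k : Fin n) (f : MvPolynomial (Fin n) K) (i : Fin n) :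
    ⁅(pderiv k : VF K n), monoField f i⁆ = monoField (pderiv k f) i := by
  rw [← monoField_one k, lie_monoField, pderiv_one, mul_zero, monoField_zero, sub_zero, one_mul]
  rw [monoField_one]

theorem divergence_monoField (f : MvPolynomial (Fin n) K) (i : Fin n) :
    divergence (monoField f i) = pderiv i f := by
  simp_rw [divergence, monoField_apply_X]
  rw [Finset.sum_eq_single i]
  · simp
  · intro j _ h; simp [h]
  · simp

theorem divergence_pderiv (k : Fin n) : divergence (pderiv k : VF K n) = 0 := by
  rw [← monoField_one, divergence_monoField, pderiv_one]

theorem derivation_finset_sum_apply {ι : Type*} (s : Finset ι) (D : ι → VF K n)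
    (f : MvPolynomial (Fin n) K) : (∑ i ∈ s, D i) f = ∑ i ∈ s, D i f := by
  have h := congrFun (map_sum (Derivation.coeFnAddMonoidHom (R := K)
    (A := MvPolynomial (Fin n) K) (M := MvPolynomial (Fin n) K)) D s) f
  rw [Finset.sum_apply] at h
  exact h

theorem eq_sum_monoField (δ : VF K n) : δ = ∑ i, monoField (δ (X i)) i := by
  apply Derivation.ext
  intro f
  rw [apply_eq_sum, derivation_finset_sum_apply]
  rfl

/-- The diagonal linear vector field `∑ b_i x_i ∂ / ∂ x_i`. -/
def diagField (b : Fin n → K) : VF K n := mkDerivation K fun i => C (b i) * X i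

theorem diagField_apply_X (b : Fin n → K) (i : Fin n) :
    diagField b (X i) = C (b i) * X i := mkDerivation_X _ _ _

theorem diagField_apply_monomial (b : Fin n → K) (s : Fin n →₀ ℕ) (r : K) :
    diagField b (monomial s r) = (∑ i, (s i : K) * b i) • monomial s r := by
  rw [diagField, mkDerivation_monomial, Finsupp.sum_fintype _ _ (by simp), Finset.smul_sum,
    Finset.sum_smul]
  refine Finset.sum_congr rfl fun i _ => ?_
  rcases Nat.eq_zero_or_pos (s i) with h | h
  · simp [h]
  · have hs : s - Finsupp.single i 1 + Finsupp.single i 1 = s :=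
      tsub_add_cancel_of_le (Finsupp.single_le_iff.mpr h)
    rw [smul_eq_mul, smul_monomial, X, C_mul_monomial, monomial_mul, hs, smul_monomial]
    congr 1
    simp only [smul_eq_mul]
    ring

theorem lie_pderiv_diagField (k : Fin n) (b : Fin n → K) :
    ⁅(pderiv k : VF K n), diagField b⁆ = b k • (pderiv k : VF K n) := by
  apply MvPolynomial.derivation_ext
  intro i
  rw [Derivation.commutator_apply, diagField_apply_X, pderiv_C_mul, Derivation.smul_apply,
    pderiv_X, Pi.single_apply]
  split_ifs with h
  · subst h; simp [smul_eq_C_mul]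
  · simp

theorem derivation_map_C_mul (D : VF K n) (c : K) (f : MvPolynomial (Fin n) K) :
    D (C c * f) = C c * D f := by
  rw [C_mul', D.map_smul, C_mul']

theorem lie_diagField_diagField (a b : Fin n → K) : ⁅diagField a, diagField b⁆ = 0 := by
  apply MvPolynomial.derivation_ext
  intro i
  rw [Derivation.commutator_apply, diagField_apply_X, diagField_apply_X, derivation_map_C_mul,
    derivation_map_C_mul, diagField_apply_X, diagField_apply_X, Derivation.zero_apply]
  ring

theorem lie_diagField_monoField (b : Fin n → K) (s : Fin n →₀ ℕ) (r : K) (l : Fin n) :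
    ⁅diagField b, monoField (monomial s r) l⁆ =
      ((∑ i, (s i : K) * b i) - b l) • monoField (monomial s r) l := by
  apply MvPolynomial.derivation_ext
  intro i
  rw [Derivation.commutator_apply, diagField_apply_X, derivation_map_C_mul, Derivation.smul_apply,
    monoField_apply_X]
  split_ifs with h
  · subst h
    rw [diagField_apply_monomial, sub_smul, C_mul']
  · simp

theorem divergence_diagField (b : Fin n → K) : divergence (diagField b) = C (∑ i, b i) := by
  simp_rw [divergence, diagField_apply_X, pderiv_C_mul, pderiv_X_self, mul_one, map_sum]

theorem exists_eq_C_of_pderiv_eq_zero [CharZero K] {f : MvPolynomial (Fin n) K}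
    (h : ∀ k, pderiv k f = 0) : ∃ c, f = C c := by
  refine ⟨coeff 0 f, ?_⟩
  ext s
  rw [coeff_C]
  split_ifs with hs
  · rw [hs]
  · obtain ⟨i, hi⟩ : ∃ i, s i ≠ 0 := by
      by_contra! hc
      exact hs (Finsupp.ext fun i => (hc i).symm)
    have h1 := coeff_pderiv (i := i) f (s - Finsupp.single i 1)
    rw [h i, coeff_zero, tsub_add_cancel_of_le (Finsupp.single_le_iff.mpr (Nat.one_le_iff_ne_zero.mpr hi))]
      at h1
    exact (mul_eq_zero.mp h1.symm).resolve_right (Nat.cast_add_one_ne_zero _)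

theorem exists_pderiv_eq [CharZero K] (k : Fin n) (g : MvPolynomial (Fin n) K) :
    ∃ f, pderiv k f = g := by
  induction g using MvPolynomial.induction_on' with
  | monomial s r =>
    refine ⟨monomial (s + Finsupp.single k 1) (r / ((s k : K) + 1)), ?_⟩
    have h2 : (s k : K) + 1 ≠ 0 := Nat.cast_add_one_ne_zero _
    rw [pderiv_monomial]
    simp [h2]
  | add p q hp hq =>
    obtain ⟨f, hf⟩ := hp
    obtain ⟨g, hg⟩ := hq
    exact ⟨f + g, by rw [map_add, hf, hg]⟩

theorem isLocNil_pderiv (k : Fin n) : IsLocNil (pderiv k : VF K n) :=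
  isLocNil_of_X fun i => ⟨2, by
    change pderiv k (pderiv k (X i)) = 0
    rw [pderiv_X, Pi.single_apply]
    split_ifs <;> simp⟩

/-- Some power of `ad D` kills the vector field `E`. -/
def IsAdNilAt (D E : VF K n) : Prop := ∃ m : ℕ, (fun F => ⁅D, F⁆)^[m] E = 0

theorem isAdNilAt_pderiv (k : Fin n) (E : VF K n) : IsAdNilAt (pderiv k) E := by
  choose m hm using fun i => isLocNil_pderiv (K := K) k (E (X i))
  refine ⟨Finset.univ.sup m, ?_⟩
  have key : ∀ (l : ℕ) (E : VF K n) (i : Fin n),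
      ((fun F => ⁅(pderiv k : VF K n), F⁆)^[l] E) (X i) = (pderiv k)^[l] (E (X i)) := by
    intro l
    induction l with
    | zero => intro E i; rfl
    | succ l ih =>
      intro E i
      rw [Function.iterate_succ_apply, Function.iterate_succ_apply, ih,
        Derivation.commutator_apply, pderiv_X, Pi.single_apply]
      split_ifs <;> simp
  apply MvPolynomial.derivation_ext
  intro i
  rw [key, Derivation.zero_apply]
  exact iterate_eq_zero_of_le (Finset.le_sup (Finset.mem_univ i)) (hm i)

/-- Without divergence, `D` acts on the determinant through the brackets with single rows. Each
bracket lowers the total of the nilpotency orders, on which the induction runs. -/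
theorem isNilAt_det_coeffMatrix {D : VF K n} (hD : divergence D = 0) {E : Fin n → VF K n}
    (hE : ∀ i, IsAdNilAt D (E i)) : IsNilAt D (coeffMatrix E).det := by
  choose m hm using hE
  induction hs : ∑ i, m i using Nat.strong_induction_on generalizing m E with
  | _ s ih =>
  by_cases h0 : ∃ i, m i = 0
  · obtain ⟨i, hi⟩ := h0
    have hEi : E i = 0 := by simpa [hi] using hm i
    rw [Matrix.det_eq_zero_of_row_eq_zero i (by simp [coeffMatrix, hEi])]
    exact isNilAt_zero D
  · push Not at h0
    apply IsNilAt.of_apply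
    rw [derivation_det_coeffMatrix, hD, zero_mul, add_zero]
    refine isNilAt_sum fun i _ => ih _ ?_ (Function.update m i (m i - 1)) ?_ rfl
    · rw [← hs]
      refine Finset.sum_lt_sum (fun j _ => ?_) ⟨i, Finset.mem_univ i, ?_⟩
      · by_cases h : j = i
        · subst h; simp
        · simp [h]
      · have := h0 i
        simp; omega
    · intro j
      by_cases h : j = i
      · subst h
        have := hm j
        obtain ⟨r, hr⟩ := Nat.exists_eq_succ_of_ne_zero (h0 j)
        simpa [hr] using this
      · simpa [h] using hm j

end Fields

/-! ### Functions dual to commuting derivations are coordinates. -/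

section Dixmier

variable {K : Type*} [Field K] {n : ℕ}

theorem derivation_aeval_dual {D : Fin n → VF K n} {f : Fin n → MvPolynomial (Fin n) K}
    (hf : ∀ k l, D k (f l) = if k = l then 1 else 0) (k : Fin n) (p : MvPolynomial (Fin n) K) :
    D k (aeval f p) = aeval f (pderiv k p) := by
  induction p using MvPolynomial.induction_on with
  | C c => simp [derivation_C, algebraMap_eq]
  | add p q hp hq => simp only [map_add, hp, hq]
  | mul_X p j hp =>
    rw [map_mul, Derivation.leibniz, hp, aeval_X, hf, Derivation.leibniz, pderiv_X,
      Pi.single_apply, map_add]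
    simp only [smul_eq_mul, map_mul, aeval_X, eq_comm (a := k)]
    split_ifs <;> simp

theorem iterate_apply_eq_zero_of_commute {D E : VF K n} (h : ⁅D, E⁆ = 0)
    {f : MvPolynomial (Fin n) K} (hf : D f = 0) (m : ℕ) : D (E^[m] f) = 0 := by
  have hc : Function.Commute D E := fun g => by
    have := congrArg (fun F : VF K n => F g) h
    simpa [Derivation.commutator_apply, sub_eq_zero] using this
  rw [hc.iterate_right m f, hf, iterate_map_zero]

theorem lie_pderiv_pderiv (i j : Fin n) : ⁅(pderiv i : VF K n), (pderiv j : VF K n)⁆ = 0 := by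
  rw [← monoField_one (K := K) j, lie_pderiv_monoField, pderiv_one, monoField_zero]

/-- By the chain rule, derivatives of a relation among the `f l` are again relations.
Differentiating in each variable up to the last nonzero derivative leaves a nonzero constant
relation. -/
theorem aeval_injective_of_dual [CharZero K] {D : Fin n → VF K n}
    {f : Fin n → MvPolynomial (Fin n) K} (hf : ∀ k l, D k (f l) = if k = l then 1 else 0) :
    Function.Injective (aeval f : MvPolynomial (Fin n) K →ₐ[K] MvPolynomial (Fin n) K) := by
  rw [injective_iff_map_eq_zero]
  by_contra! hc
  have key : ∀ t : Finset (Fin n), ∃ p : MvPolynomial (Fin n) K,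
      aeval f p = 0 ∧ p ≠ 0 ∧ ∀ k ∈ t, pderiv k p = 0 := by
    intro t
    induction t using Finset.induction_on with
    | empty =>
      obtain ⟨p, hp, hp0⟩ := hc
      exact ⟨p, hp, hp0, by simp⟩
    | insert a t ha ih =>
      obtain ⟨p, hp, hp0, ht⟩ := ih
      obtain ⟨m, hm, hm'⟩ := exists_last_iterate (isLocNil_pderiv a p) hp0
      refine ⟨_, ?_, hm', ?_⟩
      · clear hm hm'
        induction m with
        | zero => exact hp
        | succ m ih => rw [Function.iterate_succ_apply', ← derivation_aeval_dual hf, ih, map_zero]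
      · intro k hk
        rcases Finset.mem_insert.mp hk with rfl | hk
        · rwa [Function.iterate_succ_apply'] at hm
        · exact iterate_apply_eq_zero_of_commute (lie_pderiv_pderiv k a) (ht k hk) m
  obtain ⟨p, hp, hp0, h⟩ := key Finset.univ
  obtain ⟨c, rfl⟩ := exists_eq_C_of_pderiv_eq_zero fun k => h k (Finset.mem_univ k)
  rw [aeval_C, algebraMap_eq] at hp
  exact hp0 hp

/-- A Taylor expansion: if `D a ^ (m + 1)` kills `g`, subtracting `f_a^m * D_a^m(g) / m!` lowers the
order in `D a`, and the coefficient `D_a^m(g)` is killed by one more derivation. The induction is on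
the set of derivations allowed not to kill `g`, and ends at scalars by `hker`. -/
theorem aeval_surjective_of_dual [CharZero K] {D : Fin n → VF K n}
    (hD : ∀ k, IsLocNil (D k)) (hcomm : ∀ k l, ⁅D k, D l⁆ = 0)
    (hker : ∀ g, (∀ k, D k g = 0) → ∃ c : K, g = C c)
    {f : Fin n → MvPolynomial (Fin n) K} (hf : ∀ k l, D k (f l) = if k = l then 1 else 0) :
    Function.Surjective (aeval f : MvPolynomial (Fin n) K →ₐ[K] MvPolynomial (Fin n) K) := by
  have key : ∀ (t : Finset (Fin n)) (g : MvPolynomial (Fin n) K), (∀ k ∉ t, D k g = 0) →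
      g ∈ (aeval f : MvPolynomial (Fin n) K →ₐ[K] MvPolynomial (Fin n) K).range := by
    intro t
    induction t using Finset.induction_on with
    | empty =>
      intro g hg
      obtain ⟨c, rfl⟩ := hker g fun k => hg k (by simp)
      exact ⟨C c, by simp [algebraMap_eq]⟩
    | insert a t ha ih =>
      intro g hg
      obtain ⟨m, hm⟩ := hD a g
      induction m generalizing g with
      | zero =>
        have : g = 0 := hm
        rw [this]
        exact zero_mem _
      | succ m ihm =>
        set c := (D a)^[m] g with hc
        have hca : D a c = 0 := by rwa [Function.iterate_succ_apply'] at hm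
        have hct : ∀ k ∉ insert a t, D k c = 0 := fun k hk =>
          iterate_apply_eq_zero_of_commute (hcomm k a) (hg k hk) m
        have hcmem := ih c fun k hk => by
          by_cases h : k = a
          · rw [h, hca]
          · exact hct k (by simp [h, hk])
        have hfmem : f a ∈ (aeval f : MvPolynomial (Fin n) K →ₐ[K] _).range :=
          ⟨X a, aeval_X f a⟩
        have hfac : (m.factorial : K) ≠ 0 := by exact_mod_cast m.factorial_ne_zero
        have hsub : g - (m.factorial : K)⁻¹ • (f a ^ m * c) ∈
            (aeval f : MvPolynomial (Fin n) K →ₐ[K] MvPolynomial (Fin n) K).range := by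
          apply ihm
          · intro k hk
            have hka : k ≠ a := fun h => hk (by simp [h])
            rw [map_sub, Derivation.map_smul, Derivation.leibniz, hct k hk,
              Derivation.leibniz_pow, hf, if_neg hka, hg k hk]
            simp
          · have hsmul : (m.factorial : K)⁻¹ • (f a ^ m * c) =
                f a ^ m * ((m.factorial : K)⁻¹ • c) := by rw [mul_smul_comm]
            rw [iterate_map_sub, hsmul, iterate_pow_mul (D a) (by rw [hf, if_pos rfl]) m
              (by rw [Derivation.map_smul, hca, smul_zero]), smul_smul, mul_inv_cancel₀ hfac,
              one_smul, sub_self]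
        have := add_mem hsub (Subalgebra.smul_mem _ (mul_mem (pow_mem hfmem m) hcmem)
          (m.factorial : K)⁻¹)
        rwa [sub_add_cancel] at this
  intro g
  exact key Finset.univ g (by simp)

end Dixmier

/-! ### Straightening a frame to the coordinate fields. -/

section Frame

variable {K : Type*} [Field K] {n : ℕ}

/-- The properties of the coordinate vector fields `∂ / ∂ x_k` in a Lie algebra `L` of vector
fields which are preserved by automorphisms of `L`. -/
structure IsFrame (L : LieSubalgebra K (VF K n)) (D : Fin n → VF K n) : Prop where
  mem : ∀ k, D k ∈ L
  comm : ∀ k l, ⁅D k, D l⁆ = 0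
  cent : ∀ E ∈ L, (∀ k, ⁅D k, E⁆ = 0) → ∃ c : Fin n → K, E = ∑ k, c k • D k
  indep : ∀ c : Fin n → K, ∑ k, c k • D k = 0 → c = 0
  adNil : ∀ k, ∀ E ∈ L, IsAdNilAt (D k) E

theorem isFrame_pderiv [CharZero K] {L : LieSubalgebra K (VF K n)}
    (hL : ∀ k, (pderiv k : VF K n) ∈ L) : IsFrame L fun k => pderiv k where
  mem := hL
  comm := lie_pderiv_pderiv
  cent E _ h := by
    have h1 : ∀ i, ∃ c : K, E (X i) = C c := fun i =>
      exists_eq_C_of_pderiv_eq_zero fun k => by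
        have := congrArg (fun F : VF K n => F (X i)) (h k)
        simp only [Derivation.commutator_apply, pderiv_X, Pi.single_apply,
          Derivation.zero_apply] at this
        split_ifs at this <;> simpa using this
    choose c hc using h1
    refine ⟨c, ?_⟩
    rw [eq_sum_monoField E]
    refine Finset.sum_congr rfl fun i _ => ?_
    rw [hc, ← monoField_one i, ← monoField_smul, smul_eq_C_mul, mul_one]
  indep c h := by
    funext i
    have := congrArg (fun F : VF K n => F (X i)) h
    simpa [derivation_finset_sum_apply, pderiv_X, Pi.single_apply, smul_eq_C_mul] using this
  adNil k E _ := isAdNilAt_pderiv k E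

theorem iterate_lie_map {L : LieSubalgebra K (VF K n)} (θ : L ≃ₗ⁅K⁆ L) (D E : L) (m : ℕ) :
    (fun F => ⁅(θ D : VF K n), F⁆)^[m] (θ E : VF K n) = (θ ((fun F : L => ⁅D, F⁆)^[m] E) : VF K n) := by
  induction m with
  | zero => rfl
  | succ m ih => rw [Function.iterate_succ_apply', ih, Function.iterate_succ_apply',
      LieEquiv.map_lie, LieSubalgebra.coe_bracket]

theorem iterate_lie_coe {L : LieSubalgebra K (VF K n)} (D E : L) (m : ℕ) :
    (((fun F : L => ⁅D, F⁆)^[m] E : L) : VF K n) = (fun F => ⁅(D : VF K n), F⁆)^[m] (E : VF K n) := by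
  induction m with
  | zero => rfl
  | succ m ih => rw [Function.iterate_succ_apply', Function.iterate_succ_apply',
      LieSubalgebra.coe_bracket, ih]

theorem IsFrame.map {L : LieSubalgebra K (VF K n)} {D : Fin n → VF K n} (h : IsFrame L D)
    (θ : L ≃ₗ⁅K⁆ L) : IsFrame L fun k => (θ ⟨D k, h.mem k⟩ : VF K n) where
  mem k := (θ ⟨D k, h.mem k⟩).2
  comm k l := by
    rw [← LieSubalgebra.coe_bracket, ← LieEquiv.map_lie]
    have : ⁅(⟨D k, h.mem k⟩ : L), (⟨D l, h.mem l⟩ : L)⁆ = 0 := Subtype.ext (h.comm k l)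
    rw [this, map_zero, ZeroMemClass.coe_zero]
  cent E hE hc := by
    obtain ⟨E', hE'⟩ : ∃ E', θ E' = ⟨E, hE⟩ := θ.surjective _
    obtain ⟨c, hc⟩ := h.cent E' E'.2 fun k => by
      have h1 : ⁅θ ⟨D k, h.mem k⟩, (⟨E, hE⟩ : L)⁆ = 0 := Subtype.ext (hc k)
      rw [← hE', ← LieEquiv.map_lie, ← map_zero θ] at h1
      exact congrArg Subtype.val (θ.injective h1)
    refine ⟨c, ?_⟩
    have h2 : E' = ∑ k, c k • (⟨D k, h.mem k⟩ : L) := Subtype.ext (by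
      rw [hc]; simp)
    have h3 : (θ E' : VF K n) = E := congrArg Subtype.val hE'
    rw [← h3, h2, map_sum]
    simp only [map_smul, AddSubmonoidClass.coe_finsetSum, SetLike.val_smul]
  indep c hc := by
    apply h.indep
    have h1 : θ (∑ k, c k • (⟨D k, h.mem k⟩ : L)) = 0 := Subtype.ext (by
      rw [map_sum]; simpa only [map_smul, AddSubmonoidClass.coe_finsetSum,
        SetLike.val_smul, ZeroMemClass.coe_zero] using hc)
    rw [← map_zero θ] at h1
    have := congrArg Subtype.val (θ.injective h1)
    simpa using this
  adNil k E hE := by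
    obtain ⟨E', hE'⟩ : ∃ E', θ E' = ⟨E, hE⟩ := θ.surjective _
    obtain ⟨m, hm⟩ := h.adNil k E' E'.2
    refine ⟨m, ?_⟩
    have h3 : (θ E' : VF K n) = E := congrArg Subtype.val hE'
    have h4 : (fun F => ⁅(⟨D k, h.mem k⟩ : L), F⁆)^[m] E' = 0 :=
      Subtype.ext (by rw [iterate_lie_coe]; exact hm)
    rw [← h3, iterate_lie_map, h4, map_zero, ZeroMemClass.coe_zero]

instance isTorsionFree_VF : Module.IsTorsionFree (MvPolynomial (Fin n) K) (VF K n) :=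
  Function.Injective.moduleIsTorsionFree (N := MvPolynomial (Fin n) K → MvPolynomial (Fin n) K)
    (fun D => ⇑D) DFunLike.coe_injective fun _ _ => rfl

theorem lie_smul_of_commute {D E : VF K n} (h : ⁅D, E⁆ = 0) (f : MvPolynomial (Fin n) K) :
    ⁅D, f • E⁆ = D f • E := by
  apply Derivation.ext
  intro g
  have h1 := congrArg (fun F : VF K n => F g) h
  simp only [Derivation.commutator_apply, Derivation.zero_apply] at h1
  rw [Derivation.commutator_apply, Derivation.smul_apply, Derivation.smul_apply,
    Derivation.smul_apply, smul_eq_mul, Derivation.leibniz, smul_eq_mul, smul_eq_mul,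
    smul_eq_mul, smul_eq_mul]
  linear_combination f * h1

theorem lie_zero_right (D : VF K n) : ⁅D, (0 : VF K n)⁆ = 0 := lie_zero D

theorem sub_smul_field (p q : MvPolynomial (Fin n) K) (D : VF K n) :
    (p - q) • D = p • D - q • D := sub_smul p q D

theorem lie_sum_smul_of_commute {D : VF K n} {E : Fin n → VF K n} (h : ∀ l, ⁅D, E l⁆ = 0)
    (p : Fin n → MvPolynomial (Fin n) K) :
    ⁅D, ∑ l, p l • E l⁆ = ∑ l, D (p l) • E l := by
  refine (map_sum (LieAlgebra.ad K (VF K n) D) _ _).trans ?_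
  exact Finset.sum_congr rfl fun l _ => lie_smul_of_commute (h l) (p l)

/-- The constants of a frame are the scalars. -/
theorem IsFrame.exists_eq_C [IsAlgClosed K] {L : LieSubalgebra K (VF K n)} {D : Fin n → VF K n}
    (hD : IsFrame L D)
    (hL : ∀ f : MvPolynomial (Fin n) K, (∀ k, D k f = 0) → ∀ k, f • D k ∈ L)
    {f : MvPolynomial (Fin n) K} (hf : ∀ k, D k f = 0) : ∃ c, f = C c := by
  rcases isEmpty_or_nonempty (Fin n) with hn | ⟨⟨k₀⟩⟩
  · exact ⟨_, eq_C_of_isEmpty f⟩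
  set N : Submodule K (VF K n) := Submodule.span K (Set.range D)
  have hk₀ : D k₀ ≠ 0 := fun h0 => by
    have := hD.indep (Pi.single k₀ 1) (by
      rw [Finset.sum_eq_single k₀ (fun j _ hj => by simp [hj]) (by simp), h0, smul_zero])
    simpa using congrFun this k₀
  -- Each `f • D l` lies in `L` and commutes with the frame, so multiplication by `f` preserves the
  -- nonzero finite-dimensional span `N`; integrality is Cayley–Hamilton.
  have hint : IsIntegral K f := by
    refine isIntegral_of_smul_mem_submodule N ?_ (Submodule.fg_span (Set.finite_range D)) f ?_
    · exact (Submodule.ne_bot_iff _).mpr ⟨D k₀, Submodule.subset_span ⟨k₀, rfl⟩, hk₀⟩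
    · intro E hE
      induction hE using Submodule.span_induction with
      | mem E hE =>
        obtain ⟨l, rfl⟩ := hE
        obtain ⟨c, hc⟩ := hD.cent _ (hL f hf l) fun k => by
          rw [lie_smul_of_commute (hD.comm k l), hf k, zero_smul]
        rw [hc]
        exact Submodule.sum_mem _ fun k _ =>
          Submodule.smul_mem _ _ (Submodule.subset_span ⟨k, rfl⟩)
      | zero => rw [smul_zero]; exact zero_mem _
      | add E F _ _ hE hF => rw [smul_add]; exact add_mem hE hF
      | smul a E _ hE => rw [smul_comm]; exact Submodule.smul_mem _ _ hE
  let B : Subalgebra K (MvPolynomial (Fin n) K) := integralClosure K _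
  obtain ⟨c, hc⟩ := (IsAlgClosed.algebraMap_bijective_of_isIntegral (k := K) (K := B)).2
    ⟨f, hint⟩
  exact ⟨c, (congrArg Subtype.val hc).symm⟩

/-- All `D k` annihilate the fraction `p / q`. In lowest terms `a / b` this forces `a` to divide `D
k a` and `b` to divide `D k b`, so local nilpotency makes both derivatives zero and `a`, `b`
scalars. -/
theorem exists_eq_C_mul_of_forall_wronskian [CharZero K] {D : Fin n → VF K n}
    (hnil : ∀ k, IsLocNil (D k)) (hker : ∀ f, (∀ k, D k f = 0) → ∃ c : K, f = C c)
    {p q : MvPolynomial (Fin n) K} (hq : q ≠ 0) (h : ∀ k, D k p * q = p * D k q) :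
    ∃ c : K, p = C c * q := by
  obtain ⟨a, b, r, hrel, rfl, rfl⟩ := UniqueFactorizationMonoid.exists_reduced_factors' p q hq
  obtain ⟨hr, hb⟩ := mul_ne_zero_iff.mp hq
  have hab : ∀ k, D k a * b = a * D k b := fun k => by
    have := h k
    rw [Derivation.leibniz, Derivation.leibniz, smul_eq_mul, smul_eq_mul, smul_eq_mul,
      smul_eq_mul] at this
    refine mul_left_cancel₀ (mul_ne_zero hr hr) ?_
    linear_combination this
  have ha0 : ∀ k, D k a = 0 := fun k => by
    obtain ⟨u, hu⟩ := hrel.dvd_of_dvd_mul_right (Dvd.intro _ (hab k).symm)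
    rw [mul_comm] at hu
    rw [hu, (hnil k).eq_zero_of_apply_eq_mul hu]
  have hb0 : ∀ k, D k b = 0 := fun k => by
    obtain ⟨u, hu⟩ := hrel.symm.dvd_of_dvd_mul_left (Dvd.intro_left _ (hab k))
    rw [mul_comm] at hu
    rw [hu, (hnil k).eq_zero_of_apply_eq_mul hu]
  obtain ⟨c, hc⟩ := hker a ha0
  obtain ⟨d, hd⟩ := hker b hb0
  subst hc hd
  have hd0 : d ≠ 0 := fun h0 => hb (by rw [h0, C_0])
  refine ⟨c / d, ?_⟩
  rw [mul_comm r (C d), ← mul_assoc, ← C_mul, div_mul_cancel₀ _ hd0, mul_comm]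

/-- Bracketing a relation with `D k` differentiates its coefficients. Eliminating index `a` between
the two relations gives a shorter one, so the Wronskians with `p a` vanish and every coefficient is
a scalar multiple of `p a`. Dividing by `p a` contradicts independence over `K`. -/
theorem IsFrame.eq_zero_of_sum_smul_eq_zero [CharZero K] {L : LieSubalgebra K (VF K n)}
    {D : Fin n → VF K n} (hD : IsFrame L D) (hnil : ∀ k, IsLocNil (D k))
    (hker : ∀ f, (∀ k, D k f = 0) → ∃ c : K, f = C c) {p : Fin n → MvPolynomial (Fin n) K}
    (hp : ∑ l, p l • D l = 0) : p = 0 := by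
  have key : ∀ (t : Finset (Fin n)) (p : Fin n → MvPolynomial (Fin n) K),
      (∀ i ∉ t, p i = 0) → ∑ l, p l • D l = 0 → p = 0 := by
    intro t
    induction t using Finset.induction_on with
    | empty => exact fun p h _ => funext fun i => h i (by simp)
    | insert a t ha ih =>
      intro p hpt hp
      by_cases hpa : p a = 0
      · refine ih p (fun i hi => ?_) hp
        by_cases h : i = a
        · rw [h, hpa]
        · exact hpt i (by simp [h, hi])
      exfalso
      have h1 : ∀ k i, D k (p i) * p a = p i * D k (p a) := by
        intro k i
        have h2 : ∑ l, D k (p l) • D l = 0 := by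
          rw [← lie_sum_smul_of_commute (hD.comm k), hp, lie_zero_right]
        have h3 := ih (fun l => p a * D k (p l) - D k (p a) * p l) (fun i hi => by
            by_cases h : i = a
            · rw [h]; ring
            · rw [hpt i (by simp [h, hi]), map_zero]; ring) (by
          simp_rw [sub_smul_field, mul_smul]
          rw [Finset.sum_sub_distrib, ← Finset.smul_sum, ← Finset.smul_sum, h2, hp, smul_zero,
            smul_zero, sub_zero])
        have h4 := congrFun h3 i
        simp only [Pi.zero_apply] at h4
        linear_combination h4
      choose c hc using fun i =>
        exists_eq_C_mul_of_forall_wronskian hnil hker hpa fun k => h1 k i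
      have h5 : p a • ∑ l, c l • D l = 0 := by
        rw [← hp, Finset.smul_sum]
        refine Finset.sum_congr rfl fun l _ => ?_
        conv_rhs => rw [hc l]
        rw [← smul_eq_C_mul, smul_assoc, smul_comm]
      have h6 := hD.indep c ((smul_eq_zero.mp h5).resolve_left hpa)
      apply hpa
      rw [hc a, h6]
      simp
  exact key Finset.univ p (by simp) hp

/-- The coefficient determinant of a locally nilpotent frame is a nonzero scalar, so that the frame
is a basis of the module of vector fields. -/
theorem IsFrame.exists_eq_sum_smul [CharZero K] {L : LieSubalgebra K (VF K n)}
    {D : Fin n → VF K n} (hD : IsFrame L D) (hnil : ∀ k, IsLocNil (D k))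
    (hker : ∀ f, (∀ k, D k f = 0) → ∃ c : K, f = C c) (E : VF K n) :
    ∃ p : Fin n → MvPolynomial (Fin n) K, E = ∑ l, p l • D l := by
  have hdet : (coeffMatrix D).det ≠ 0 := by
    intro h0
    obtain ⟨v, hv, hv0⟩ := Matrix.exists_vecMul_eq_zero_iff.mpr h0
    apply hv
    apply hD.eq_zero_of_sum_smul_eq_zero hnil hker
    apply MvPolynomial.derivation_ext
    intro j
    have := congrFun hv0 j
    rw [derivation_finset_sum_apply]
    simpa [Matrix.vecMul, dotProduct, coeffMatrix] using this
  obtain ⟨c, hc⟩ := hker (coeffMatrix D).det fun k => by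
    -- The bracket terms vanish because the frame commutes, so the determinant is an eigenvector
    -- with polynomial eigenvalue `divergence (D k)`.
    have h1 : D k (coeffMatrix D).det = divergence (D k) * (coeffMatrix D).det := by
      rw [derivation_det_coeffMatrix, Finset.sum_eq_zero, zero_add]
      intro i _
      refine Matrix.det_eq_zero_of_row_eq_zero i fun j => ?_
      simp [coeffMatrix, hD.comm]
    rw [h1, (hnil k).eq_zero_of_apply_eq_mul h1]
  have hunit : IsUnit (coeffMatrix D).det := by
    rw [hc]
    exact (isUnit_iff_ne_zero.mpr fun h0 => hdet (by rw [hc, h0, C_0])).map C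
  refine ⟨Matrix.vecMul (fun j => E (X j)) (coeffMatrix D)⁻¹, ?_⟩
  apply MvPolynomial.derivation_ext
  intro j
  rw [derivation_finset_sum_apply]
  have h1 : Matrix.vecMul (Matrix.vecMul (fun j => E (X j)) (coeffMatrix D)⁻¹) (coeffMatrix D) =
      fun j => E (X j) := by
    rw [Matrix.vecMul_vecMul, Matrix.nonsing_inv_mul _ hunit, Matrix.vecMul_one]
  have h2 := congrFun h1 j
  rw [← h2]
  rfl

/-- A locally nilpotent frame with a diagonal element is conjugate to the coordinate vector
fields. -/
theorem IsFrame.exists_algEquiv [CharZero K] {L : LieSubalgebra K (VF K n)}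
    {D : Fin n → VF K n} (hD : IsFrame L D) (hnil : ∀ k, IsLocNil (D k))
    (hker : ∀ f, (∀ k, D k f = 0) → ∃ c : K, f = C c) {a : Fin n → K} (ha : ∀ k, a k ≠ 0)
    {H : VF K n} (hH : ∀ k, ⁅D k, H⁆ = a k • D k) :
    ∃ s : MvPolynomial (Fin n) K ≃ₐ[K] MvPolynomial (Fin n) K,
      (∀ k, conj s (D k) = pderiv k) ∧ conj s H = diagField a := by
  obtain ⟨p, hp⟩ := hD.exists_eq_sum_smul hnil hker H
  -- Comparing coefficients in `⁅D k, H⁆ = a k • D k`: up to the scalars `a l`, the coefficients of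
  -- `H` are the sought coordinates.
  have h1 : ∀ k l, D k (p l) = if k = l then C (a k) else 0 := by
    intro k
    have h2 := hH k
    rw [hp, lie_sum_smul_of_commute (hD.comm k)] at h2
    have h3 := hD.eq_zero_of_sum_smul_eq_zero hnil hker
      (p := fun l => D k (p l) - if k = l then C (a k) else 0) (by
        simp_rw [sub_smul_field]
        rw [Finset.sum_sub_distrib, h2, sub_eq_zero,
          Finset.sum_eq_single k (fun j _ hj => by simp [hj.symm]) (by simp), if_pos rfl]
        apply Derivation.ext
        intro g
        simp [smul_eq_C_mul])
    intro l
    exact sub_eq_zero.mp (congrFun h3 l)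
  let f : Fin n → MvPolynomial (Fin n) K := fun l => C (a l)⁻¹ * p l
  have hf : ∀ k l, D k (f l) = if k = l then 1 else 0 := by
    intro k l
    rw [derivation_map_C_mul, h1]
    split_ifs with h
    · subst h
      rw [← C_mul, inv_mul_cancel₀ (ha k), C_1]
    · rw [mul_zero]
  have hpf : ∀ l, p l = C (a l) * f l := fun l => by
    rw [← mul_assoc, ← C_mul, mul_inv_cancel₀ (ha l), C_1, one_mul]
  let s := AlgEquiv.ofBijective (aeval f : MvPolynomial (Fin n) K →ₐ[K] MvPolynomial (Fin n) K)
    ⟨aeval_injective_of_dual hf, aeval_surjective_of_dual hnil hD.comm hker hf⟩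
  have hs : ∀ l, s (X l) = f l := fun l => aeval_X f l
  refine ⟨s, fun k => ?_, ?_⟩
  · apply MvPolynomial.derivation_ext
    intro l
    rw [conj_apply, hs, hf, pderiv_X, Pi.single_apply]
    simp only [eq_comm (a := k)]
    split_ifs <;> simp
  · apply MvPolynomial.derivation_ext
    intro l
    rw [conj_apply, hs, AlgEquiv.symm_apply_eq, diagField_apply_X, map_mul s, hs, hp,
      derivation_finset_sum_apply, Finset.sum_eq_single l (fun j _ hj => by simp [hf, hj])
      (by simp), Derivation.smul_apply, hf, if_pos rfl, smul_eq_mul, mul_one, hpf]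
    congr 1
    exact (s.commutes (a l)).symm

end Frame

/-! ### Conjugation and divergence. -/

section Conjugation

variable {K : Type*} [Field K] {n : ℕ}

/-- Conjugation by an algebra automorphism, as a Lie algebra homomorphism. -/
def conjHom (s : MvPolynomial (Fin n) K ≃ₐ[K] MvPolynomial (Fin n) K) :
    VF K n →ₗ⁅K⁆ VF K n where
  toFun := conj s
  map_add' δ η := by ext; simp [conj_apply]
  map_smul' c δ := by ext; simp [conj_apply]
  map_lie' {δ η} := by ext; simp [conj_apply, Derivation.commutator_apply]

theorem conj_lie (s : MvPolynomial (Fin n) K ≃ₐ[K] MvPolynomial (Fin n) K) (δ η : VF K n) :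
    conj s ⁅δ, η⁆ = ⁅conj s δ, conj s η⁆ := (conjHom s).map_lie δ η

theorem conj_symm_conj (s : MvPolynomial (Fin n) K ≃ₐ[K] MvPolynomial (Fin n) K) (δ : VF K n) :
    conj s.symm (conj s δ) = δ := by
  ext; simp [conj_apply]

theorem isLocNil_conj {D : VF K n} (hD : IsLocNil D)
    (s : MvPolynomial (Fin n) K ≃ₐ[K] MvPolynomial (Fin n) K) : IsLocNil (conj s D) := by
  intro f
  obtain ⟨m, hm⟩ := hD (s f)
  refine ⟨m, ?_⟩
  have key : (conj s D)^[m] f = s.symm (D^[m] (s f)) := by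
    clear hm
    induction m with
    | zero => simp
    | succ m ih =>
      rw [Function.iterate_succ_apply', Function.iterate_succ_apply', ih, conj_apply,
        AlgEquiv.apply_symm_apply]
  rw [key, hm, map_zero]

theorem divergence_smul_field (p : MvPolynomial (Fin n) K) (D : VF K n) :
    divergence (p • D) = D p + p * divergence D := by
  simp only [divergence, Derivation.smul_apply, smul_eq_mul, Derivation.leibniz]
  rw [Finset.sum_add_distrib, apply_eq_sum D p, Finset.mul_sum, add_comm]

theorem divergence_sum {ι : Type*} (s : Finset ι) (D : ι → VF K n) :
    divergence (∑ i ∈ s, D i) = ∑ i ∈ s, divergence (D i) := by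
  simp only [divergence, derivation_finset_sum_apply, map_sum]
  exact Finset.sum_comm

/-- The transported fields `conj s.symm (pderiv l)` are dual to the coordinates `s (X l)`. -/
theorem eq_sum_smul_conj_pderiv (s : MvPolynomial (Fin n) K ≃ₐ[K] MvPolynomial (Fin n) K)
    (δ : VF K n) : δ = ∑ l, δ (s (X l)) • conj s.symm (pderiv l) := by
  have h : conj s δ = ∑ l, monoField (conj s δ (X l)) l := eq_sum_monoField _
  rw [← conj_symm_conj s δ, h]
  apply Derivation.ext
  intro f
  rw [derivation_finset_sum_apply, conj_apply, derivation_finset_sum_apply, map_sum]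
  refine Finset.sum_congr rfl fun l _ => ?_
  rw [← h, conj_symm_conj]
  simp [monoField_apply, conj_apply]

/-- The conjugated coordinate fields commute and their coefficient matrix is inverse to a Jacobian
matrix. Its nonzero determinant is an eigenvector of a locally nilpotent derivation with eigenvalue
the divergence, which must vanish. -/
theorem divergence_conj_pderiv [CharZero K]
    (s : MvPolynomial (Fin n) K ≃ₐ[K] MvPolynomial (Fin n) K) (l : Fin n) :
    divergence (conj s (pderiv l)) = 0 := by
  have hnil := isLocNil_conj (isLocNil_pderiv (K := K) l) s
  set D : Fin n → VF K n := fun l => conj s (pderiv l)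
  have hunit : (Matrix.of fun j i => pderiv j (s.symm (X i)) :
      Matrix (Fin n) (Fin n) (MvPolynomial (Fin n) K)) * coeffMatrix D = 1 := by
    ext1 j k
    have h := congrArg (fun F : VF K n => F (X k)) (eq_sum_smul_conj_pderiv s.symm (pderiv j))
    rw [derivation_finset_sum_apply, pderiv_X, Pi.single_apply] at h
    rw [Matrix.mul_apply, Matrix.one_apply]
    simp only [eq_comm (a := j)]
    exact h.symm
  have hdet : (coeffMatrix D).det ≠ 0 := by
    intro h0
    have := congrArg Matrix.det hunit
    rw [Matrix.det_mul, h0, mul_zero, Matrix.det_one] at this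
    exact zero_ne_one this
  have h1 : D l (coeffMatrix D).det = divergence (D l) * (coeffMatrix D).det := by
    rw [derivation_det_coeffMatrix, Finset.sum_eq_zero, zero_add]
    intro i _
    refine Matrix.det_eq_zero_of_row_eq_zero i fun j => ?_
    have : ⁅D l, D i⁆ = 0 := by
      rw [← conj_lie, lie_pderiv_pderiv]
      exact (conjHom s).map_zero
    simp [coeffMatrix, this]
  exact (mul_eq_zero.mp (hnil.eq_zero_of_apply_eq_mul h1)).resolve_right hdet

theorem divergence_conj [CharZero K] (s : MvPolynomial (Fin n) K ≃ₐ[K] MvPolynomial (Fin n) K)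
    (δ : VF K n) : divergence (conj s δ) = s.symm (divergence δ) := by
  conv_rhs => rw [eq_sum_smul_conj_pderiv s δ]
  rw [divergence_sum, map_sum]
  refine Finset.sum_congr rfl fun l _ => ?_
  rw [divergence_smul_field, divergence_conj_pderiv, mul_zero, add_zero]
  simp [conj_apply]

end Conjugation

/-! ### From ad-nilpotent to locally nilpotent. -/

section LocallyNilpotent

variable {K : Type*} [Field K] {n : ℕ}

/-- Replacing `∂_j` by `x_i ∂_j` among the coordinate fields gives coefficient determinant `x_i`.
Any `j` will do, which leaves room for `j ≠ i` in the divergence-free case. -/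
theorem isLocNil_of_isAdNilAt_of_divergence {L : LieSubalgebra K (VF K n)} {D : VF K n}
    (hdiv : divergence D = 0) (hD : ∀ E ∈ L, IsAdNilAt D E)
    (hL : ∀ k, (pderiv k : VF K n) ∈ L) (hX : ∀ i, ∃ j, monoField (X i : MvPolynomial _ K) j ∈ L) :
    IsLocNil D := by
  refine isLocNil_of_X fun i => ?_
  obtain ⟨j, hj⟩ := hX i
  have h := isNilAt_det_coeffMatrix hdiv
    (E := Function.update (fun k => pderiv k) j (monoField (X i) j)) fun k => by
      by_cases h : k = j
      · subst h; simpa using hD _ hj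
      · simpa [h] using hD _ (hL k)
  have h1 : coeffMatrix (Function.update (fun k => pderiv k) j (monoField (X i) j)) =
      Matrix.updateRow (1 : Matrix (Fin n) (Fin n) (MvPolynomial (Fin n) K)) j
        ((X i : MvPolynomial (Fin n) K) • (1 : Matrix (Fin n) (Fin n) _) j) := by
    ext1 k l
    rw [Matrix.updateRow_apply]
    by_cases h : k = j
    · subst h
      simp [coeffMatrix, monoField_apply_X, Matrix.one_apply, eq_comm (a := l)]
    · simp [coeffMatrix, h, pderiv_X, Pi.single_apply, Matrix.one_apply, eq_comm (a := l)]
  rw [h1, Matrix.det_updateRow_smul, Matrix.updateRow_eq_self, Matrix.det_one, mul_one] at h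
  exact h

/-- The test field is `f • D`: since `D` commutes with itself, `ad D` acts on it by differentiating
`f`. -/
theorem isLocNil_of_isAdNilAt {D : VF K n} (hD : ∀ E, IsAdNilAt D E) : IsLocNil D := by
  intro f
  by_cases h0 : D = 0
  · exact isNilAt_of_apply_eq_zero (by rw [h0, Derivation.zero_apply])
  obtain ⟨m, hm⟩ := hD (f • D)
  refine ⟨m, ?_⟩
  have key : (fun F => ⁅D, F⁆)^[m] (f • D) = D^[m] f • D := by
    clear hm
    induction m with
    | zero => rfl
    | succ m ih =>
      rw [Function.iterate_succ_apply', ih, lie_smul_of_commute (lie_self D),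
        Function.iterate_succ_apply']
  rw [key] at hm
  exact (smul_eq_zero.mp hm).resolve_right h0

end LocallyNilpotent

/-! ### Homomorphisms fixing the coordinate fields and a diagonal field. -/

section Fixed

variable {K : Type*} [Field K] {n : ℕ}

/-- The vector fields of `L` fixed by a Lie algebra homomorphism. -/
def fixedFields {L : LieSubalgebra K (VF K n)} (F : L →ₗ⁅K⁆ VF K n) :
    LieSubalgebra K (VF K n) where
  carrier := {δ | ∃ h : δ ∈ L, F ⟨δ, h⟩ = δ}
  add_mem' := by
    rintro δ η ⟨h1, h2⟩ ⟨h3, h4⟩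
    refine ⟨add_mem h1 h3, ?_⟩
    have := map_add F ⟨δ, h1⟩ ⟨η, h3⟩
    rwa [h2, h4] at this
  zero_mem' := ⟨zero_mem _, F.map_zero⟩
  smul_mem' := by
    rintro c δ ⟨h1, h2⟩
    refine ⟨L.smul_mem c h1, ?_⟩
    have := map_smul F c ⟨δ, h1⟩
    rwa [h2] at this
  lie_mem' := by
    rintro δ η ⟨h1, h2⟩ ⟨h3, h4⟩
    refine ⟨L.lie_mem h1 h3, ?_⟩
    have := F.map_lie ⟨δ, h1⟩ ⟨η, h3⟩
    rwa [h2, h4] at this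

theorem monoField_sum {ι : Type*} (s : Finset ι) (f : ι → MvPolynomial (Fin n) K) (j : Fin n) :
    monoField (∑ i ∈ s, f i) j = ∑ i ∈ s, monoField (f i) j := Finset.sum_smul

theorem monoField_C_mem_fixedFields {L : LieSubalgebra K (VF K n)}
    {F : L →ₗ⁅K⁆ VF K n} (hp : ∀ k, (pderiv k : VF K n) ∈ fixedFields F) (c : K) (j : Fin n) : monoField (C c) j ∈ fixedFields F := by
  have := (fixedFields F).smul_mem c (hp j)
  rwa [← monoField_one, ← monoField_smul, smul_eq_C_mul, mul_one] at this

variable [CharZero K] {L : LieSubalgebra K (VF K n)} {F : L →ₗ⁅K⁆ VF K n}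

/-- The difference `F δ - δ` commutes with all `∂_k`, so it has constant coefficients. It also has
weight `w` under `diagField b`, whereas `∂_k` has weight `-b k`. -/
theorem mem_fixedFields_of_weight (hp : ∀ k, (pderiv k : VF K n) ∈ fixedFields F) {δ : VF K n}
    (hδ : δ ∈ L) (hk : ∀ k, ⁅(pderiv k : VF K n), δ⁆ ∈ fixedFields F) {b : Fin n → K}
    (hb : diagField b ∈ fixedFields F) {w : K} (hw : ⁅diagField b, δ⁆ = w • δ)
    (hne : ∀ k, w + b k ≠ 0) : δ ∈ fixedFields F := by
  refine ⟨hδ, ?_⟩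
  have hlie : ∀ η (hη : η ∈ fixedFields F) (h : ⁅η, δ⁆ ∈ L),
      F ⟨⁅η, δ⁆, h⟩ = ⁅η, F ⟨δ, hδ⟩⁆ := by
    intro η hη h
    have := F.map_lie ⟨η, hη.1⟩ ⟨δ, hδ⟩
    rwa [hη.2] at this
  have hsub : ∀ η : VF K n, ⁅η, F ⟨δ, hδ⟩ - δ⁆ = ⁅η, F ⟨δ, hδ⟩⁆ - ⁅η, δ⁆ := fun η =>
    lie_sub η _ _
  have hconst : ∀ i, ∃ c : K, (F ⟨δ, hδ⟩ - δ) (X i) = C c := fun i =>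
    exists_eq_C_of_pderiv_eq_zero fun k => by
      have h1 : ⁅(pderiv k : VF K n), F ⟨δ, hδ⟩ - δ⁆ = 0 := by
        rw [hsub, ← hlie _ (hp k) (hk k).1, (hk k).2, sub_self]
      have h2 := congrArg (fun F : VF K n => F (X i)) h1
      simp only [Derivation.commutator_apply, pderiv_X, Pi.single_apply,
        Derivation.zero_apply] at h2
      split_ifs at h2 <;> simpa using h2
  have hdiag : ⁅diagField b, F ⟨δ, hδ⟩ - δ⁆ = w • (F ⟨δ, hδ⟩ - δ) := by
    have h1 : ⁅diagField b, δ⁆ ∈ L := by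
      rw [hw]
      exact L.smul_mem w hδ
    have h2 : F ⟨⁅diagField b, δ⁆, h1⟩ = w • F ⟨δ, hδ⟩ := by
      rw [← map_smul]
      congr 1
      exact Subtype.ext hw
    rw [hsub, ← hlie _ hb h1, h2, hw, smul_sub]
  rw [← sub_eq_zero]
  apply MvPolynomial.derivation_ext
  intro i
  obtain ⟨c, hc⟩ := hconst i
  have h3 := congrArg (fun F : VF K n => F (X i)) hdiag
  simp only [Derivation.commutator_apply, diagField_apply_X, derivation_map_C_mul,
    Derivation.smul_apply, hc, derivation_C, zero_sub, smul_eq_C_mul] at h3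
  rw [← C_mul, ← C_mul, ← C_neg] at h3
  have h4 := C_injective _ _ h3
  have h5 : (w + b i) * c = 0 := by linear_combination -h4
  rw [hc, (mul_eq_zero.mp h5).resolve_left (hne i), C_0, Derivation.zero_apply]

theorem diagField_mem_fixedFields (hp : ∀ k, (pderiv k : VF K n) ∈ fixedFields F)
    {a : Fin n → K} (ha : ∀ k, a k ≠ 0) (haF : diagField a ∈ fixedFields F) {b : Fin n → K}
    (hb : diagField b ∈ L) : diagField b ∈ fixedFields F := by
  refine mem_fixedFields_of_weight hp hb (fun k => ?_) haF (w := 0) ?_ fun k => ?_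
  · rw [lie_pderiv_diagField]
    exact (fixedFields F).smul_mem _ (hp k)
  · rw [lie_diagField_diagField, zero_smul]
  · rw [zero_add]
    exact ha k

theorem monoField_single_mem_fixedFields (hL : VF0 K n ≤ L)
    (hp : ∀ k, (pderiv k : VF K n) ∈ fixedFields F)
    (hdiag : ∀ b, diagField b ∈ L → diagField b ∈ fixedFields F) {l j : Fin n} (hlj : l ≠ j)
    (d : ℕ) : ∀ c : K, monoField (monomial (Finsupp.single l d) c) j ∈ fixedFields F := by
  induction d with
  | zero =>
    intro c
    rw [Finsupp.single_zero]
    exact monoField_C_mem_fixedFields hp c j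
  | succ d ih =>
    intro c
    -- These weights sum to zero, so the diagonal field has divergence zero. The monomial field has
    -- weight `d + 2`, and adding an entry `1`, `-1` or `0` never gives zero.
    have hb : diagField (Pi.single l 1 - Pi.single j 1 : Fin n → K) ∈ fixedFields F := by
      apply hdiag
      apply hL
      change divergence _ = 0
      rw [divergence_diagField]
      simp
    have hmem : monoField (monomial (Finsupp.single l (d + 1)) c) j ∈ L := by
      apply hL
      change divergence _ = 0
      rw [divergence_monoField, pderiv_monomial]
      simp [hlj.symm]
    refine mem_fixedFields_of_weight hp hmem (fun k => ?_) hb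
      (lie_diagField_monoField _ _ _ _) fun k => ?_
    · rw [lie_pderiv_monoField]
      by_cases h : k = l
      · subst h
        rw [pderiv_monomial_single, Nat.add_sub_cancel]
        exact ih _
      · rw [pderiv_monomial]
        simp [h, monoField_zero, zero_mem]
    · have hsum : (∑ i, ((Finsupp.single l (d + 1) i : ℕ) : K) *
          (Pi.single l 1 - Pi.single j 1 : Fin n → K) i) = d + 1 := by
        rw [Finset.sum_eq_single l (fun i _ hi => by simp [hi.symm])
          (by simp)]
        simp [hlj]
      have hbj : (Pi.single l 1 - Pi.single j 1 : Fin n → K) j = -1 := by simp [hlj.symm]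
      rw [hsum, hbj]
      by_cases hkl : k = l
      · have hv : (Pi.single l 1 - Pi.single j 1 : Fin n → K) k = 1 := by simp [hkl, hlj]
        rw [hv, sub_neg_eq_add]
        exact_mod_cast (by omega : d + 1 + 1 + 1 ≠ 0)
      · by_cases hkj : k = j
        · have hv : (Pi.single l 1 - Pi.single j 1 : Fin n → K) k = -1 := by
            simp [hkj, hlj.symm]
          rw [hv, sub_neg_eq_add, add_neg_cancel_right]
          exact Nat.cast_add_one_ne_zero d
        · have hv : (Pi.single l 1 - Pi.single j 1 : Fin n → K) k = 0 := by simp [hkl, hkj]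
          rw [hv, add_zero, sub_neg_eq_add]
          exact_mod_cast (by omega : d + 1 + 1 ≠ 0)

theorem monoField_monomial_mem_fixedFields (hL : VF0 K n ≤ L)
    (hp : ∀ k, (pderiv k : VF K n) ∈ fixedFields F)
    (hdiag : ∀ b, diagField b ∈ L → diagField b ∈ fixedFields F) (t : Finset (Fin n)) :
    ∀ (s : Fin n →₀ ℕ) (c : K) (j : Fin n), s.support ⊆ t → s j = 0 →
      monoField (monomial s c) j ∈ fixedFields F := by
  induction t using Finset.induction_on with
  | empty =>
    intro s c j hs _
    rw [Finsupp.support_eq_empty.mp (Finset.subset_empty.mp hs)]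
    exact monoField_C_mem_fixedFields hp c j
  | insert i t hi ih =>
    intro s c j hs hsj
    by_cases hsi : s i = 0
    · refine ih s c j (fun k hk => ?_) hsj
      exact (Finset.mem_insert.mp (hs hk)).resolve_left fun h =>
        (Finsupp.mem_support_iff.mp hk) (h ▸ hsi)
    have hij : i ≠ j := fun h => hsi (h ▸ hsj)
    have h1 := ih (s.erase i) c i (fun k hk => by
      rw [Finsupp.support_erase, Finset.mem_erase] at hk
      exact (Finset.mem_insert.mp (hs hk.2)).resolve_left hk.1) Finsupp.erase_same
    -- The exponent is raised by one because the bracket with the field along `∂_i` differentiates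
    -- it once; the factor `s i + 1` is then divided out.
    have h2 := monoField_single_mem_fixedFields hL hp hdiag hij (s i + 1) (1 : K)
    have h3 := (fixedFields F).lie_mem h1 h2
    have h4 : pderiv j (monomial (s.erase i) c) = 0 := by
      rw [pderiv_monomial, Finsupp.erase_ne hij.symm, hsj]
      simp
    rw [lie_monoField, h4, mul_zero, monoField_zero, sub_zero, pderiv_monomial_single,
      Nat.add_sub_cancel, monomial_mul, Finsupp.erase_add_single, one_mul] at h3
    have h5 := (fixedFields F).smul_mem ((s i + 1 : ℕ) : K)⁻¹ h3
    rwa [← monoField_smul, smul_monomial, smul_eq_mul, mul_comm c,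
      inv_mul_cancel_left₀ (Nat.cast_ne_zero.mpr (Nat.succ_ne_zero _))] at h5

theorem monoField_mem_fixedFields (hL : VF0 K n ≤ L)
    (hp : ∀ k, (pderiv k : VF K n) ∈ fixedFields F)
    (hdiag : ∀ b, diagField b ∈ L → diagField b ∈ fixedFields F) {f : MvPolynomial (Fin n) K}
    {j : Fin n} (hf : pderiv j f = 0) : monoField f j ∈ fixedFields F := by
  rw [← support_sum_monomial_coeff f, monoField_sum]
  refine sum_mem fun s hs => ?_
  refine monoField_monomial_mem_fixedFields hL hp hdiag Finset.univ s _ j (Finset.subset_univ _) ?_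
  by_contra hsj
  have h := coeff_pderiv (i := j) f (s - Finsupp.single j 1)
  rw [hf, coeff_zero, tsub_add_cancel_of_le
    (Finsupp.single_le_iff.mpr (Nat.one_le_iff_ne_zero.mpr hsj))] at h
  exact mem_support_iff.mp hs
    ((mul_eq_zero.mp h.symm).resolve_right (Nat.cast_add_one_ne_zero _))

/-- For a monomial `g = p * q` with `q` its power of `x_j`, the field is the bracket of `p ∂_j` and
`q ∂_i`, as `∂_j p = 0` and `∂_i q = 0`. -/
theorem hamiltonian_mem_fixedFields (hL : VF0 K n ≤ L)
    (hp : ∀ k, (pderiv k : VF K n) ∈ fixedFields F)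
    (hdiag : ∀ b, diagField b ∈ L → diagField b ∈ fixedFields F) {i j : Fin n} (hij : i ≠ j)
    (g : MvPolynomial (Fin n) K) :
    monoField (pderiv j g) i - monoField (pderiv i g) j ∈ fixedFields F := by
  induction g using MvPolynomial.induction_on' with
  | monomial s r =>
    have hp0 : pderiv j (monomial (s.erase j) r) = 0 := by
      rw [pderiv_monomial, Finsupp.erase_same]; simp
    have hq0 : pderiv i (monomial (Finsupp.single j (s j)) (1 : K)) = 0 := by
      rw [pderiv_monomial]; simp [hij]
    have h := (fixedFields F).lie_mem (monoField_mem_fixedFields hL hp hdiag hp0)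
      (monoField_mem_fixedFields hL hp hdiag hq0)
    have hg : monomial s r =
        monomial (s.erase j) r * monomial (Finsupp.single j (s j)) (1 : K) := by
      rw [monomial_mul, Finsupp.erase_add_single, mul_one]
    rw [lie_monoField] at h
    rw [hg, Derivation.leibniz, Derivation.leibniz, hp0, hq0]
    simpa only [smul_eq_mul, mul_zero, add_zero, zero_add] using h
  | add p q hp' hq' =>
    have := add_mem hp' hq'
    rw [map_add, map_add, monoField_add, monoField_add]
    convert this using 1
    abel

theorem VF0_le_fixedFields (hL : VF0 K n ≤ L) (hp : ∀ k, (pderiv k : VF K n) ∈ fixedFields F)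
    (hdiag : ∀ b, diagField b ∈ L → diagField b ∈ fixedFields F) : VF0 K n ≤ fixedFields F := by
  intro δ hδ
  rcases isEmpty_or_nonempty (Fin n) with hn | ⟨⟨z⟩⟩
  · have : δ = 0 := MvPolynomial.derivation_ext fun i => hn.elim i
    rw [this]
    exact zero_mem _
  choose g hg using fun l => exists_pderiv_eq z (δ (X l))
  -- Each `g l` is an antiderivative of `δ (X l)` in `x_z`, so `η` matches `δ` in every direction
  -- but `z`. The remainder is a divergence-free multiple of `∂_z`, whose coefficient does not
  -- involve `x_z`.
  set η : VF K n := ∑ l ∈ Finset.univ.erase z,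
    (monoField (pderiv z (g l)) l - monoField (pderiv l (g l)) z) with hη
  have hηmem : η ∈ fixedFields F := sum_mem fun l hl =>
    hamiltonian_mem_fixedFields hL hp hdiag (Finset.ne_of_mem_erase hl) (g l)
  have hηdiv : divergence η = 0 := by
    rw [hη, divergence_sum]
    refine Finset.sum_eq_zero fun l _ => ?_
    rw [sub_eq_add_neg, ← neg_one_smul K, divergence_add, divergence_smul, divergence_monoField,
      divergence_monoField, pderiv_comm']
    simp
  have hX : ∀ j, j ≠ z → (δ - η) (X j) = 0 := by
    intro j hj
    rw [Derivation.sub_apply, hη, derivation_finset_sum_apply, Finset.sum_eq_single j]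
    · rw [Derivation.sub_apply, monoField_apply_X, monoField_apply_X, if_pos rfl, if_neg hj, hg,
        sub_zero, sub_self]
    · intro b _ hb
      rw [Derivation.sub_apply, monoField_apply_X, monoField_apply_X, if_neg hb.symm, if_neg hj,
        sub_zero]
    · intro h
      exact absurd (Finset.mem_erase.mpr ⟨hj, Finset.mem_univ j⟩) h
  have hsub : δ - η = monoField ((δ - η) (X z)) z := by
    conv_lhs => rw [eq_sum_monoField (δ - η)]
    exact Finset.sum_eq_single z (fun j _ hj => by rw [hX j hj, monoField_zero]) (by simp)
  have hdiv : divergence (δ - η) = 0 := by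
    have h1 := divergence_add (δ - η) η
    rw [sub_add_cancel, hηdiv, add_zero] at h1
    rw [← h1]
    exact hδ
  rw [hsub, divergence_monoField] at hdiv
  have h := add_mem (monoField_mem_fixedFields hL hp hdiag hdiv) hηmem
  rwa [← hsub, sub_add_cancel] at h

theorem VFc_le_fixedFields (hL : VFc K n ≤ L) (hp : ∀ k, (pderiv k : VF K n) ∈ fixedFields F)
    (hdiag : ∀ b, diagField b ∈ L → diagField b ∈ fixedFields F) : VFc K n ≤ fixedFields F := by
  rintro δ ⟨c, hc⟩
  have h0 := VF0_le_fixedFields ((VF0_le_VFc K n).trans hL) hp hdiag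
  rcases Nat.eq_zero_or_pos n with hn | hn
  · subst hn
    exact h0 (by change divergence δ = 0; simp [divergence])
  -- This multiple of the Euler field has divergence `c` and reduces the claim to divergence zero;
  -- dividing by `n` is why `n = 0` is treated apart.
  have hE : diagField (fun _ => c / n) ∈ fixedFields F :=
    hdiag _ (hL ⟨_, divergence_diagField _⟩)
  have hsub : δ - diagField (fun _ => c / n) ∈ VF0 K n := by
    change divergence _ = 0
    have hn' : (n : K) ≠ 0 := Nat.cast_ne_zero.mpr hn.ne'
    rw [sub_eq_add_neg, ← neg_one_smul K, divergence_add, divergence_smul, divergence_diagField,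
      hc]
    simp [mul_div_cancel₀ _ hn']
  have h := add_mem (h0 hsub) hE
  rwa [sub_add_cancel] at h

/-- Induction on degree: the Euler field has weight `|s| - 1` on `x^s ∂_j`, which differs from the
weight `-1` of a constant field as soon as `|s| > 0`. -/
theorem fixedFields_eq_top {F : (⊤ : LieSubalgebra K (VF K n)) →ₗ⁅K⁆ VF K n}
    (hp : ∀ k, (pderiv k : VF K n) ∈ fixedFields F)
    (hE : diagField (fun _ => 1) ∈ fixedFields F) : fixedFields F = ⊤ := by
  have key : ∀ (N : ℕ) (s : Fin n →₀ ℕ) (r : K) (j : Fin n), ∑ i, s i = N →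
      monoField (monomial s r) j ∈ fixedFields F := by
    intro N
    induction N with
    | zero =>
      intro s r j hs
      have : s = 0 := Finsupp.ext fun i => by
        simpa using Finset.sum_eq_zero_iff.mp hs i (Finset.mem_univ i)
      rw [this]
      exact monoField_C_mem_fixedFields hp r j
    | succ N ih =>
      intro s r j hs
      refine mem_fixedFields_of_weight hp (LieSubalgebra.mem_top _) (fun k => ?_) hE
        (lie_diagField_monoField _ _ _ _) fun k => ?_
      · rw [lie_pderiv_monoField, pderiv_monomial]
        by_cases hk : s k = 0
        · simp [hk, monoField_zero, zero_mem]
        · refine ih _ _ j ?_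
          have h1 : s = (s - Finsupp.single k 1) + Finsupp.single k 1 :=
            (tsub_add_cancel_of_le
              (Finsupp.single_le_iff.mpr (Nat.one_le_iff_ne_zero.mpr hk))).symm
          rw [h1] at hs
          simp only [Finsupp.add_apply, Finset.sum_add_distrib, Finsupp.single_apply] at hs
          simpa using hs
      · have : ∑ i, (s i : K) * 1 = N + 1 := by
          simp_rw [mul_one]
          exact_mod_cast congrArg (Nat.cast : ℕ → K) hs
        rw [this]
        simpa using Nat.cast_add_one_ne_zero (R := K) N
  rw [eq_top_iff]
  intro δ _
  rw [eq_sum_monoField δ]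
  refine sum_mem fun j _ => ?_
  rw [← support_sum_monomial_coeff (δ (X j)), monoField_sum]
  exact sum_mem fun s _ => key _ s _ j rfl

end Fixed

/-! ### Automorphisms of the three Lie algebras. -/

section Automorphisms

variable {K : Type*} [Field K] {n : ℕ}

theorem conj_comp_mem_fixedFields_iff {L : LieSubalgebra K (VF K n)} (θ : L ≃ₗ⁅K⁆ L)
    (s : MvPolynomial (Fin n) K ≃ₐ[K] MvPolynomial (Fin n) K) (δ : VF K n) :
    δ ∈ fixedFields ((conjHom s).comp (L.incl.comp θ.toLieHom)) ↔
      ∃ h : δ ∈ L, conj s (θ ⟨δ, h⟩) = δ := Iff.rfl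

theorem pderiv_mem_VF0 (k : Fin n) : (pderiv k : VF K n) ∈ VF0 K n := divergence_pderiv k

theorem pderiv_mem_VFc (k : Fin n) : (pderiv k : VF K n) ∈ VFc K n :=
  VF0_le_VFc K n (pderiv_mem_VF0 k)

theorem diagField_mem_VFc (b : Fin n → K) : diagField b ∈ VFc K n :=
  ⟨_, divergence_diagField b⟩

variable [CharZero K]

theorem exists_comorphism_eq (s : MvPolynomial (Fin n) K ≃ₐ[K] MvPolynomial (Fin n) K) :
    ∃ φ : Aut K n, comorphism φ = s := by
  have key : ∀ (s : MvPolynomial (Fin n) K ≃ₐ[K] MvPolynomial (Fin n) K) (a : Fin n → K)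
      (p : MvPolynomial (Fin n) K), eval (fun i => eval a (s (X i))) p = eval a (s p) := by
    intro s a p
    induction p using MvPolynomial.induction_on with
    | C c =>
      have : s (C c) = C c := s.commutes c
      rw [this, eval_C, eval_C]
    | add p q hp hq => rw [map_add, map_add, map_add, hp, hq]
    | mul_X p j hp => rw [map_mul, map_mul, map_mul, hp, eval_X]
  refine ⟨⟨⟨fun a i => eval a (s (X i)), fun a i => eval a (s.symm (X i)), fun a => ?_,
    fun a => ?_⟩, ⟨fun i => s (X i), fun _ _ => rfl⟩, ⟨fun i => s.symm (X i), fun _ _ => rfl⟩⟩, ?_⟩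
  · funext i
    refine (key s a (s.symm (X i))).trans ?_
    rw [AlgEquiv.apply_symm_apply, eval_X]
  · funext i
    refine (key s.symm a (s (X i))).trans ?_
    rw [AlgEquiv.symm_apply_apply, eval_X]
  · apply AlgEquiv.ext
    intro p
    apply MvPolynomial.funext
    intro a
    rw [eval_comorphism]
    exact key s a p

/-- Fixing all `∂_k` leaves only translations, and a diagonal field with nonzero weights is fixed by
no nontrivial translation. -/
theorem eq_one_of_Ad_apply_eq {φ : Aut K n}
    (hp : ∀ k, Ad K n φ (pderiv k) = pderiv k) {a : Fin n → K} (ha : ∀ k, a k ≠ 0)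
    (haφ : Ad K n φ (diagField a) = diagField a) : φ = 1 := by
  have hX : ∀ i, comorphism φ (X i) = X i := by
    intro i
    have h1 : ∀ k, pderiv k (comorphism φ (X i) - X i) = 0 := by
      intro k
      have := congrArg (fun F : VF K n => F (X i)) (hp k)
      simp only [Ad_apply, AlgEquiv.symm_apply_eq] at this
      rw [map_sub, this, pderiv_X, Pi.single_apply]
      split_ifs <;> simp
    obtain ⟨c, hc⟩ := exists_eq_C_of_pderiv_eq_zero h1
    have h2 : comorphism φ (X i) = X i + C c := by rw [← hc]; ring
    have h3 := congrArg (fun F : VF K n => F (X i)) haφ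
    simp only [Ad_apply, AlgEquiv.symm_apply_eq] at h3
    have h4 : comorphism φ (C (a i)) = C (a i) := (comorphism φ).commutes (a i)
    rw [diagField_apply_X, map_mul (comorphism φ), h2, h4, map_add, derivation_C, add_zero,
      diagField_apply_X, mul_add, left_eq_add, ← C_mul] at h3
    have h5 : a i * c = 0 := C_injective _ _ (by rw [h3, C_0])
    rw [h2, (mul_eq_zero.mp h5).resolve_left (ha i), C_0, add_zero]
  apply Subtype.ext
  apply Equiv.ext
  intro b
  funext i
  have := eval_comorphism φ b (X i)
  rw [hX, eval_X, eval_X] at this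
  exact this.symm

theorem divergence_Ad (φ : Aut K n) (δ : VF K n) :
    divergence (Ad K n φ δ) = (comorphism φ).symm (divergence δ) :=
  divergence_conj (comorphism φ) δ

theorem Ad_mem_VF0 (φ : Aut K n) {δ : VF K n} (h : δ ∈ VF0 K n) : Ad K n φ δ ∈ VF0 K n := by
  have h' : divergence δ = 0 := h
  change divergence _ = 0
  rw [divergence_Ad, h', map_zero]

theorem Ad_mem_VFc (φ : Aut K n) {δ : VF K n} (h : δ ∈ VFc K n) : Ad K n φ δ ∈ VFc K n := by
  obtain ⟨c, hc⟩ := h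
  exact ⟨c, by rw [divergence_Ad, hc]; exact (comorphism φ).symm.commutes c⟩

/-- The adjoint action on a Lie algebra of vector fields stable under all polynomial
automorphisms. -/
def AdOn (L : LieSubalgebra K (VF K n)) (hL : ∀ (φ : Aut K n), ∀ δ ∈ L, Ad K n φ δ ∈ L) :
    Aut K n →* (L ≃ₗ⁅K⁆ L) where
  toFun φ :=
    { toFun := fun δ => ⟨Ad K n φ δ, hL φ δ δ.2⟩
      map_add' := fun δ η => Subtype.ext (map_add (Ad K n φ) (δ : VF K n) η)
      map_smul' := fun c δ => Subtype.ext (map_smul (Ad K n φ) c (δ : VF K n))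
      map_lie' := fun {δ η} => Subtype.ext (LieEquiv.map_lie (Ad K n φ) (δ : VF K n) η)
      invFun := fun δ => ⟨Ad K n φ⁻¹ δ, hL φ⁻¹ δ δ.2⟩
      left_inv := fun δ => Subtype.ext (by
        change Ad K n φ⁻¹ (Ad K n φ δ) = δ
        rw [map_inv]
        exact (Ad K n φ).symm_apply_apply δ)
      right_inv := fun δ => Subtype.ext (by
        change Ad K n φ (Ad K n φ⁻¹ δ) = δ
        rw [map_inv]
        exact (Ad K n φ).apply_symm_apply δ) }
  map_one' := by
    apply DFunLike.ext
    intro δ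
    apply Subtype.ext
    change Ad K n 1 (δ : VF K n) = δ
    rw [map_one]
    rfl
  map_mul' φ ψ := by
    apply DFunLike.ext
    intro δ
    apply Subtype.ext
    change Ad K n (φ * ψ) (δ : VF K n) = Ad K n φ (Ad K n ψ δ)
    rw [map_mul]
    rfl

theorem AdOn_bijective {L : LieSubalgebra K (VF K n)}
    (hL : ∀ (φ : Aut K n), ∀ δ ∈ L, Ad K n φ δ ∈ L) (hp : ∀ k, (pderiv k : VF K n) ∈ L)
    {a : Fin n → K} (ha : ∀ k, a k ≠ 0) (haL : diagField a ∈ L)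
    (hsurj : ∀ θ : L ≃ₗ⁅K⁆ L, ∃ φ : Aut K n, ∀ δ : L, (θ δ : VF K n) = Ad K n φ δ) :
    Function.Bijective (AdOn L hL) := by
  constructor
  · rw [injective_iff_map_eq_one]
    intro φ hφ
    have h : ∀ δ (hδ : δ ∈ L), Ad K n φ δ = δ := fun δ hδ => by
      have := congrArg (fun θ : L ≃ₗ⁅K⁆ L => (θ ⟨δ, hδ⟩ : VF K n)) hφ
      exact this
    exact eq_one_of_Ad_apply_eq (fun k => h _ (hp k)) ha (h _ haL)
  · intro θ
    obtain ⟨φ, hφ⟩ := hsurj θ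
    exact ⟨φ, DFunLike.ext _ _ fun δ => Subtype.ext (hφ δ).symm⟩

theorem exists_Ad_eq_of_fixedFields {L : LieSubalgebra K (VF K n)} {θ : L ≃ₗ⁅K⁆ L}
    {s : MvPolynomial (Fin n) K ≃ₐ[K] MvPolynomial (Fin n) K}
    (h : L ≤ fixedFields ((conjHom s).comp (L.incl.comp θ.toLieHom))) :
    ∃ φ : Aut K n, ∀ δ : L, (θ δ : VF K n) = Ad K n φ δ := by
  obtain ⟨φ, hφ⟩ := exists_comorphism_eq s.symm
  refine ⟨φ, fun δ => ?_⟩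
  obtain ⟨_, h1⟩ := (conj_comp_mem_fixedFields_iff θ s δ).mp (h δ.2)
  change _ = conj (comorphism φ) δ
  rw [hφ, ← conj_symm_conj s (θ δ)]
  congr 1

/-- Normalisation: `θ` carries the coordinate frame and the diagonal field to a straightenable frame
with its `H`, and the straightening conjugation undoes `θ` on both. -/
theorem exists_conj_fixing [IsAlgClosed K] {L : LieSubalgebra K (VF K n)}
    (hp : ∀ k, (pderiv k : VF K n) ∈ L) (θ : L ≃ₗ⁅K⁆ L)
    (hnil : ∀ k, IsLocNil (θ ⟨pderiv k, hp k⟩ : VF K n))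
    (hker : ∀ f : MvPolynomial (Fin n) K, (∀ k, (θ ⟨pderiv k, hp k⟩ : VF K n) f = 0) →
      ∀ k, f • (θ ⟨pderiv k, hp k⟩ : VF K n) ∈ L)
    {a : Fin n → K} (ha : ∀ k, a k ≠ 0) (haL : diagField a ∈ L) :
    ∃ s : MvPolynomial (Fin n) K ≃ₐ[K] MvPolynomial (Fin n) K,
      (∀ k, (pderiv k : VF K n) ∈ fixedFields ((conjHom s).comp (L.incl.comp θ.toLieHom))) ∧
        diagField a ∈ fixedFields ((conjHom s).comp (L.incl.comp θ.toLieHom)) := by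
  have hD := (isFrame_pderiv hp).map θ
  obtain ⟨s, h1, h2⟩ := hD.exists_algEquiv hnil (fun f hf => hD.exists_eq_C hker hf) ha
    (H := θ ⟨diagField a, haL⟩) fun k => by
      rw [← LieSubalgebra.coe_bracket, ← LieEquiv.map_lie, ← SetLike.val_smul, ← map_smul]
      congr 2
      exact Subtype.ext (lie_pderiv_diagField k a)
  exact ⟨s, fun k => ⟨hp k, h1 k⟩, ⟨haL, h2⟩⟩

theorem exists_diagField_mem_VF0 (hn : n ≠ 1) :
    ∃ a : Fin n → K, (∀ k, a k ≠ 0) ∧ diagField a ∈ VF0 K n := by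
  rcases n with _ | n
  · exact ⟨fun _ => 1, fun _ => one_ne_zero, by change divergence _ = 0; simp [divergence]⟩
  -- In dimension `n + 1` the weights are `-n, 1, …, 1`, with sum zero; they are all nonzero exactly
  -- because the dimension is not one.
  · refine ⟨Fin.cons (-n) fun _ => 1, fun k => ?_, ?_⟩
    · refine Fin.cases ?_ (fun i => ?_) k
      · rw [Fin.cons_zero, neg_ne_zero, Nat.cast_ne_zero]
        omega
      · rw [Fin.cons_succ]
        exact one_ne_zero
    · change divergence _ = 0
      rw [divergence_diagField, Fin.sum_univ_succ]
      simp

/-- Lie algebra automorphisms of the vector fields of zero divergence, in dimension different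
from one. -/
theorem exists_Ad_eq_VF0_of_ne_one [IsAlgClosed K] (hn : n ≠ 1) (θ : VF0 K n ≃ₗ⁅K⁆ VF0 K n) :
    ∃ φ : Aut K n, ∀ δ : VF0 K n, (θ δ : VF K n) = Ad K n φ δ := by
  have hp := pderiv_mem_VF0 (K := K) (n := n)
  obtain ⟨a, ha, haL⟩ := exists_diagField_mem_VF0 (K := K) hn
  have hdiv : ∀ k, divergence (θ ⟨pderiv k, hp k⟩ : VF K n) = 0 := fun k => (θ _).2
  have hD := (isFrame_pderiv hp).map θ
  obtain ⟨s, h1, h2⟩ := exists_conj_fixing hp θ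
    (fun k => isLocNil_of_isAdNilAt_of_divergence (hdiv k) (hD.adNil k) hp fun i => by
      have : Nontrivial (Fin n) := Fin.nontrivial_iff_two_le.mpr (by have := i.pos; omega)
      obtain ⟨j, hj⟩ := exists_ne i
      refine ⟨j, ?_⟩
      change divergence _ = 0
      rw [divergence_monoField, pderiv_X_of_ne hj.symm])
    (fun f hf k => by
      change divergence _ = 0
      rw [divergence_smul_field, hf, hdiv, mul_zero, add_zero]) ha haL
  exact exists_Ad_eq_of_fixedFields
    (VF0_le_fixedFields le_rfl h1 fun b hb => diagField_mem_fixedFields h1 ha h2 hb)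

theorem exists_Ad_eq_VFc [IsAlgClosed K] (θ : VFc K n ≃ₗ⁅K⁆ VFc K n) :
    ∃ φ : Aut K n, ∀ δ : VFc K n, (θ δ : VF K n) = Ad K n φ δ := by
  have hp := pderiv_mem_VFc (K := K) (n := n)
  have hdiv : ∀ k, divergence (θ ⟨pderiv k, hp k⟩ : VF K n) = 0 := fun k => by
    -- `∂_k` is its own bracket with the Euler field, and a bracket of fields of constant divergence
    -- has divergence zero.
    have h1 : (⟨pderiv k, hp k⟩ : VFc K n) =
        ⁅(⟨pderiv k, hp k⟩ : VFc K n),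
          (⟨diagField fun _ => 1, diagField_mem_VFc _⟩ : VFc K n)⁆ :=
      Subtype.ext (by
        rw [LieSubalgebra.coe_bracket, lie_pderiv_diagField, one_smul])
    rw [h1, LieEquiv.map_lie, LieSubalgebra.coe_bracket, divergence_lie]
    obtain ⟨c, hc⟩ := (θ ⟨pderiv k, hp k⟩).2
    obtain ⟨d, hd⟩ := (θ ⟨diagField fun _ => 1, diagField_mem_VFc _⟩).2
    rw [hc, hd, derivation_C, derivation_C, sub_zero]
  have ha : ∀ k : Fin n, (fun _ => 1 : Fin n → K) k ≠ 0 := fun _ => one_ne_zero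
  have hD := (isFrame_pderiv hp).map θ
  obtain ⟨s, h1, h2⟩ := exists_conj_fixing hp θ
    (fun k => isLocNil_of_isAdNilAt_of_divergence (hdiv k) (hD.adNil k) hp fun i =>
      ⟨i, 1, by rw [divergence_monoField, pderiv_X_self, C_1]⟩)
    (fun f hf k => VF0_le_VFc K n (by
      change divergence _ = 0
      rw [divergence_smul_field, hf, hdiv, mul_zero, add_zero])) ha (diagField_mem_VFc _)
  exact exists_Ad_eq_of_fixedFields
    (VFc_le_fixedFields le_rfl h1 fun b hb => diagField_mem_fixedFields h1 ha h2 hb)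

theorem exists_Ad_eq_VF [IsAlgClosed K] (θ : VF K n ≃ₗ⁅K⁆ VF K n) :
    ∃ φ : Aut K n, ∀ δ : VF K n, θ δ = Ad K n φ δ := by
  let θ' : (⊤ : LieSubalgebra K (VF K n)) ≃ₗ⁅K⁆ (⊤ : LieSubalgebra K (VF K n)) :=
    (LieSubalgebra.topEquiv.trans θ).trans LieSubalgebra.topEquiv.symm
  have hD := (isFrame_pderiv (K := K) (n := n) (L := ⊤) fun k => LieSubalgebra.mem_top _).map θ'
  obtain ⟨s, h1, h2⟩ := exists_conj_fixing (fun k => LieSubalgebra.mem_top _) θ'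
    (fun k => isLocNil_of_isAdNilAt fun E => hD.adNil k E (LieSubalgebra.mem_top _))
    (fun _ _ _ => LieSubalgebra.mem_top _) (a := fun _ => 1) (fun _ => one_ne_zero)
    (LieSubalgebra.mem_top _)
  obtain ⟨φ, hφ⟩ := exists_Ad_eq_of_fixedFields (fixedFields_eq_top h1 h2).ge
  exact ⟨φ, fun δ => hφ ⟨δ, LieSubalgebra.mem_top _⟩⟩

theorem exists_eq_smul_pderiv_of_mem_VF0 {δ : VF K 1} (h : δ ∈ VF0 K 1) :
    ∃ c : K, δ = c • pderiv 0 := by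
  have h0 : divergence δ = 0 := h
  rw [divergence, Fin.sum_univ_one] at h0
  obtain ⟨c, hc⟩ := exists_eq_C_of_pderiv_eq_zero (f := δ (X 0)) fun k => by
    rw [Subsingleton.elim k 0, h0]
  refine ⟨c, ?_⟩
  rw [eq_sum_monoField δ, Fin.sum_univ_one, hc, ← monoField_one 0, ← monoField_smul,
    smul_eq_C_mul, mul_one]

/-- Here `VF0` is the line spanned by `∂`, so `θ` is multiplication by a nonzero scalar, realised by
a rescaling of the line. -/
theorem exists_Ad_eq_VF0_one (θ : VF0 K 1 ≃ₗ⁅K⁆ VF0 K 1) :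
    ∃ φ : Aut K 1, ∀ δ : VF0 K 1, (θ δ : VF K 1) = Ad K 1 φ δ := by
  have hp := pderiv_mem_VF0 (K := K) (n := 1)
  have hD := (isFrame_pderiv hp).map θ
  have h0 : ∀ k : Fin 1, k = 0 := fun k => Subsingleton.elim k 0
  obtain ⟨c, hc⟩ := exists_eq_smul_pderiv_of_mem_VF0 (θ ⟨pderiv 0, hp 0⟩).2
  have hc0 : c ≠ 0 := by
    rintro rfl
    have h1 := hD.indep (fun _ => 1) (by
      rw [Fin.sum_univ_one, hc, zero_smul, smul_zero])
    exact one_ne_zero (congrFun h1 0)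
  -- The Euler field is not in `VF0`, but straightening only uses its bracket relation with the
  -- frame.
  obtain ⟨s, hs, _⟩ := hD.exists_algEquiv (a := fun _ => 1) (H := diagField fun _ => 1)
    (fun k => by
      rw [h0 k, hc]
      refine isLocNil_of_X fun i => ⟨2, ?_⟩
      change (c • pderiv 0 : VF K 1) ((c • pderiv 0 : VF K 1) (X i)) = 0
      rw [h0 i, Derivation.smul_apply, Derivation.smul_apply, pderiv_X_self, Derivation.map_smul,
        pderiv_one, smul_zero, smul_zero])
    (fun f hf => exists_eq_C_of_pderiv_eq_zero fun k => by
      have := hf 0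
      rw [hc, Derivation.smul_apply] at this
      rw [h0 k]
      exact (smul_eq_zero.mp this).resolve_left hc0)
    (fun _ => one_ne_zero) fun k => by
      rw [h0 k, hc, one_smul]
      refine (smul_lie c (pderiv 0 : VF K 1) (diagField fun _ => 1)).trans ?_
      rw [lie_pderiv_diagField, one_smul]
  refine exists_Ad_eq_of_fixedFields (s := s) fun δ hδ => ?_
  obtain ⟨d, rfl⟩ := exists_eq_smul_pderiv_of_mem_VF0 hδ
  exact LieSubalgebra.smul_mem _ d ⟨hp 0, hs 0⟩

theorem exists_Ad_eq_VF0 [IsAlgClosed K] (θ : VF0 K n ≃ₗ⁅K⁆ VF0 K n) :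
    ∃ φ : Aut K n, ∀ δ : VF0 K n, (θ δ : VF K n) = Ad K n φ δ := by
  by_cases hn : n = 1
  · subst hn
    exact exists_Ad_eq_VF0_one θ
  · exact exists_Ad_eq_VF0_of_ne_one hn θ

theorem Ad_bijective [IsAlgClosed K] : Function.Bijective (Ad K n) := by
  constructor
  · rw [injective_iff_map_eq_one]
    intro φ hφ
    have h : ∀ δ, Ad K n φ δ = δ := fun δ => by rw [hφ]; rfl
    exact eq_one_of_Ad_apply_eq (a := fun _ => 1) (fun k => h _) (fun _ => one_ne_zero) (h _)
  · intro θ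
    obtain ⟨φ, hφ⟩ := exists_Ad_eq_VF θ
    exact ⟨φ, DFunLike.ext _ _ fun δ => (hφ δ).symm⟩

theorem AdOn_VFc_bijective [IsAlgClosed K] :
    Function.Bijective (AdOn (VFc K n) fun φ _ h => Ad_mem_VFc φ h) :=
  AdOn_bijective _ pderiv_mem_VFc (a := fun _ => 1) (fun _ => one_ne_zero) (diagField_mem_VFc _)
    exists_Ad_eq_VFc

theorem AdOn_VF0_bijective [IsAlgClosed K] (hn : n ≠ 1) :
    Function.Bijective (AdOn (VF0 K n) fun φ _ h => Ad_mem_VF0 φ h) := by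
  obtain ⟨a, ha, haL⟩ := exists_diagField_mem_VF0 (K := K) hn
  exact AdOn_bijective _ pderiv_mem_VF0 ha haL exists_Ad_eq_VF0

end Automorphisms

end AffineVF

end

theorem mainTheorem1 (K : Type*) [Field K] [IsAlgClosed K] [CharZero K] (n : ℕ) :
    Function.Bijective (AffineVF.Ad K n) ∧
    (∃ resC : (AffineVF.VF K n ≃ₗ⁅K⁆ AffineVF.VF K n) ≃*
        (AffineVF.VFc K n ≃ₗ⁅K⁆ AffineVF.VFc K n),
      ∀ (θ : AffineVF.VF K n ≃ₗ⁅K⁆ AffineVF.VF K n) (δ : AffineVF.VFc K n),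
        (resC θ δ : AffineVF.VF K n) = θ (δ : AffineVF.VF K n)) ∧
    (n ≠ 1 → ∃ resZ : (AffineVF.VFc K n ≃ₗ⁅K⁆ AffineVF.VFc K n) ≃*
        (AffineVF.VF0 K n ≃ₗ⁅K⁆ AffineVF.VF0 K n),
      ∀ (θ : AffineVF.VFc K n ≃ₗ⁅K⁆ AffineVF.VFc K n)
        (δ : AffineVF.VF0 K n),
        (resZ θ δ : AffineVF.VF K n) =
          θ (LieSubalgebra.inclusion (AffineVF.VF0_le_VFc K n) δ)) ∧
    (∀ θ : AffineVF.VF K n ≃ₗ⁅K⁆ AffineVF.VF K n,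
      ∃ φ : AffineVF.Aut K n, ∀ δ, θ δ = AffineVF.Ad K n φ δ) ∧
    (∀ θ : AffineVF.VFc K n ≃ₗ⁅K⁆ AffineVF.VFc K n,
      ∃ φ : AffineVF.Aut K n, ∀ δ : AffineVF.VFc K n,
        (θ δ : AffineVF.VF K n) = AffineVF.Ad K n φ δ) ∧
    (∀ θ : AffineVF.VF0 K n ≃ₗ⁅K⁆ AffineVF.VF0 K n,
      ∃ φ : AffineVF.Aut K n, ∀ δ : AffineVF.VF0 K n,
        (θ δ : AffineVF.VF K n) = AffineVF.Ad K n φ δ) := by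
  let eC := MulEquiv.ofBijective _ (AffineVF.AdOn_VFc_bijective (K := K) (n := n))
  let e := MulEquiv.ofBijective _ (AffineVF.Ad_bijective (K := K) (n := n))
  -- Each restriction map is one adjoint isomorphism inverted, followed by the adjoint isomorphism
  -- for the smaller algebra. Since every automorphism is some `Ad φ`, this composite is
  -- restriction, and stability of the subalgebra is included.
  refine ⟨AffineVF.Ad_bijective, ⟨e.symm.trans eC, fun θ δ => ?_⟩, fun hn => ?_,
    AffineVF.exists_Ad_eq_VF,
    AffineVF.exists_Ad_eq_VFc, AffineVF.exists_Ad_eq_VF0⟩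
  · obtain ⟨φ, rfl⟩ := e.surjective θ
    rw [MulEquiv.trans_apply, MulEquiv.symm_apply_apply]
    rfl
  · let eZ := MulEquiv.ofBijective _ (AffineVF.AdOn_VF0_bijective (K := K) hn)
    refine ⟨eC.symm.trans eZ, fun θ δ => ?_⟩
    obtain ⟨φ, rfl⟩ := eC.surjective θ
    rw [MulEquiv.trans_apply, MulEquiv.symm_apply_apply]
    rfl
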